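/- Let $X$ be a complex manifold and let $w\in H^0(X,S^2\Omega^1_X)$ be a holomorphic symmetric differential of degree 2. Say that $w$ has a *holomorphic exact decomposition at* $x\in X$ if there are an open neighbourhood $U$ of $x$ and holomorphic functions $f_1,f_2$ on $U$ with $w|_U=df_1\,df_2$, and that $w$ is *closed of the 1st kind* on an open subset of $X$ if it has a holomorphic exact decomposition at every point of that subset. Say that $w$ has *rank* 2 if at a general point $x\in X$ the form $w(x)$ is the product of two linearly independent linear forms on $T_xX$, i.e. $w$ defines two distinct hyperplanes in $T_xX$. **Lemma 2.6.** Suppose that $w$ has rank 2, and that there is a closed analytic subset $Z\subset X$, of codimension at least 2 at each of its points, such that $w$ is closed of the 1st kind on $X\setminus Z$. Then $w$ is closed of the 1st kind on $X$. -/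

import Mathlib

open scoped Manifold ContDiff Bundle

namespace SymDiff

noncomputable section

/-- The product `α β` of two linear forms in the symmetric square of the dual space, as the
symmetric bilinear form `(u, v) ↦ (α u * β v + β u * α v) / 2`; the corresponding homogeneous
quadratic polynomial is `v ↦ α v * β v`. -/
def symMul {V : Type*} [AddCommGroup V] [TopologicalSpace V] [IsTopologicalAddGroup V]
    [Module ℂ V] [ContinuousSMul ℂ V] (α β : V →L[ℂ] ℂ) : V →L[ℂ] V →L[ℂ] ℂ :=
  (2⁻¹ : ℂ) • (α.smulRight β + β.smulRight α)

theorem symMul_apply {V : Type*} [AddCommGroup V] [TopologicalSpace V] [IsTopologicalAddGroup V]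
    [Module ℂ V] [ContinuousSMul ℂ V] (α β : V →L[ℂ] ℂ) (u v : V) :
    symMul α β u v = (α u * β v + β u * α v) / 2 := by
  simp only [symMul, smul_apply, add_apply,
    ContinuousLinearMap.smulRight_apply, smul_eq_mul]
  ring

section Manifold

variable (E : Type*) [NormedAddCommGroup E] [NormedSpace ℂ E]
  (M : Type*) [TopologicalSpace M] [ChartedSpace E M] [IsManifold 𝓘(ℂ, E) ω M]

/-- A holomorphic symmetric differential of degree 2 on the complex manifold `M`, that is, a
holomorphic section of the second symmetric power of the cotangent bundle: a symmetric bilinear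
form on every tangent space, holomorphic as a section of the bundle of bilinear forms. -/
structure SymTwoDifferential where
  /-- the bilinear form on the tangent space at a point -/
  form : ∀ x : M, TangentSpace 𝓘(ℂ, E) x →L[ℂ] TangentSpace 𝓘(ℂ, E) x →L[ℂ] ℂ
  symm : ∀ (x : M) (u v : TangentSpace 𝓘(ℂ, E) x), form x u v = form x v u
  holomorphic : ContMDiff 𝓘(ℂ, E) (𝓘(ℂ, E).prod 𝓘(ℂ, E →L[ℂ] E →L[ℂ] ℂ)) ω
    (fun x ↦ Bundle.TotalSpace.mk' (E →L[ℂ] E →L[ℂ] ℂ)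
      (E := fun x : M ↦ TangentSpace 𝓘(ℂ, E) x →L[ℂ] TangentSpace 𝓘(ℂ, E) x →L[ℂ] ℂ)
      x (form x))

variable {M}

/-- A closed analytic subset of `M`: around every point of `M` it is the common zero set of
finitely many holomorphic functions. -/
def IsAnalyticSubset (Z : Set M) : Prop :=
  ∀ p : M, ∃ U : Set M, IsOpen U ∧ p ∈ U ∧ ∃ (k : ℕ) (h : Fin k → M → ℂ),
    (∀ i, ContMDiffOn 𝓘(ℂ, E) 𝓘(ℂ, ℂ) ω (h i) U) ∧
      ∀ y ∈ U, (y ∈ Z ↔ ∀ i, h i y = 0)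

/-- The analytic subset `Z` has codimension at least `k` at each of its points. Here
`dim_p Z ≤ n - k` is expressed in local holomorphic coordinates centred at `p`: some linear
subspace `L` of dimension `k` of the coordinate space meets `Z` only in `p` near `p`. -/
def CodimAtLeast (k : ℕ) (Z : Set M) : Prop :=
  ∀ p ∈ Z, ∃ L : Submodule ℂ E, Module.finrank ℂ L = k ∧
    ∀ᶠ y in nhdsWithin p {p}ᶜ,
      y ∈ Z → extChartAt 𝓘(ℂ, E) p y - extChartAt 𝓘(ℂ, E) p p ∉ L

namespace SymTwoDifferential

variable {E}

/-- `w` has a holomorphic exact decomposition at `x`: on an open neighbourhood `U` of `x` one has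
`w = df dg` with `f`, `g` holomorphic on `U`. -/
def HasExactDecompositionAt (w : SymTwoDifferential E M) (x : M) : Prop :=
  ∃ U : Set M, IsOpen U ∧ x ∈ U ∧ ∃ f g : M → ℂ,
    ContMDiffOn 𝓘(ℂ, E) 𝓘(ℂ, ℂ) ω f U ∧ ContMDiffOn 𝓘(ℂ, E) 𝓘(ℂ, ℂ) ω g U ∧
      ∀ y ∈ U, w.form y =
        symMul (V := TangentSpace 𝓘(ℂ, E) y)
          (mfderiv 𝓘(ℂ, E) 𝓘(ℂ, ℂ) f y) (mfderiv 𝓘(ℂ, E) 𝓘(ℂ, ℂ) g y)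

/-- `w` is closed of the 1st kind on the open set `U`: it has a holomorphic exact decomposition at
every point of `U`. -/
def IsClosedOfFirstKindOn (w : SymTwoDifferential E M) (U : Set M) : Prop :=
  ∀ x ∈ U, w.HasExactDecompositionAt x

/-- `w` is closed of the 1st kind: it has a holomorphic exact decomposition at every point. -/
def IsClosedOfFirstKind (w : SymTwoDifferential E M) : Prop :=
  ∀ x : M, w.HasExactDecompositionAt x

/-- `w` has rank 2: at a general point `x`, the form `w(x)` is a product of two linear forms
defining two distinct hyperplanes in the tangent space. Since `w` is holomorphic, this holds
outside a nowhere dense analytic subset as soon as it holds on a dense set of points. -/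
def HasRankTwo (w : SymTwoDifferential E M) : Prop :=
  Dense {x : M | ∃ α β : TangentSpace 𝓘(ℂ, E) x →L[ℂ] ℂ,
    LinearIndependent ℂ ![α, β] ∧ w.form x = symMul α β}

end SymTwoDifferential

end Manifold

end

end SymDiff

/-! ### Holomorphic dependence of integrals on parameters. -/

section ParametricIntegral

open MeasureTheory Filter Topology BoundedContinuousFunction

variable {S : Type*} [TopologicalSpace S] [MeasurableSpace S] [OpensMeasurableSpace S]
  (μ : Measure S) [IsFiniteMeasure μ]
  {X : Type*} [NormedAddCommGroup X] [NormedSpace ℂ X]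

/-! The question is local, so one works in a chart at a point `p` of `Z`. Some 2-plane `L` through
`p` meets `Z` near `p` only in `p`; hence a compact shell around `p` in `L`, slightly thickened
transversally, avoids `Z`.

Rank 2 makes decompositions rigid. On a connected open set `df₁ df₂ = dg₁ dg₂` forces, up to
exchanging the factors, `g₁ = c f₁ + d` and `g₂ = c⁻¹ f₂ + e` (`IsExactProductOn.wedge_eq_zero_or`,
`IsExactProductOn.exists_affine_of_wedge_eq_zero`). So decompositions on two open sets with
connected overlap glue after an affine change (`HasExactProductOn.union`).

The thickened shell is a 3-sphere up to homotopy, and its simple connectedness enters through a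
cover by five convex sets, the outer sides of the facets of a real 4-simplex, any three of which
meet. Local decompositions glue on each convex piece (`hasExactProductOn_of_convex`), then over the
union (`hasExactProductOn_biUnion`), giving `w = df dg` on the shell.

Finally a Hartogs argument: Cauchy integrals along complex lines parallel to a direction of `L`
extend `f` and `g` across `p`, and `w = df dg` persists by the identity theorem
(`exists_hasExactProductOn_nhds`). -/

theorem integrable_multilinear_comp {n : ℕ} (p : X [×n]→L[ℂ] ℂ) (φ : Fin n → S →ᵇ X) :
    Integrable (fun s ↦ p fun i ↦ φ i s) μ := by
  refine Integrable.of_bound (C := ‖p‖ * ∏ i, ‖φ i‖) ?_ (Eventually.of_forall fun s ↦ ?_)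
  · exact (p.cont.comp (continuous_pi fun i ↦ (φ i).continuous)).aestronglyMeasurable
  · exact (p.le_opNorm _).trans (by gcongr with i; exact (φ i).norm_coe_le_norm s)

/-- Integration of a continuous multilinear form along bounded continuous functions. -/
noncomputable def integralMultilinear {n : ℕ} (p : X [×n]→L[ℂ] ℂ) : (S →ᵇ X) [×n]→L[ℂ] ℂ :=
  MultilinearMap.mkContinuous
    { toFun := fun φ ↦ ∫ s, p (fun i ↦ φ i s) ∂μ
      map_update_add' := by
        intro _ φ i x y
        rw [← integral_add (integrable_multilinear_comp μ p _) (integrable_multilinear_comp μ p _)]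
        congr 1 with s
        have key : ∀ z : S →ᵇ X, (fun j ↦ (Function.update φ i z j) s) =
            Function.update (fun j ↦ φ j s) i (z s) := by
          intro z; ext j; by_cases h : j = i
          · subst h; simp
          · simp [h]
        simp only [key, BoundedContinuousFunction.add_apply]
        have := p.map_update_add (fun j ↦ φ j s) i (x s) (y s)
        convert this
      map_update_smul' := by
        intro _ φ i c x
        rw [smul_eq_mul, ← integral_const_mul]
        congr 1 with s
        have key : ∀ z : S →ᵇ X, (fun j ↦ (Function.update φ i z j) s) =
            Function.update (fun j ↦ φ j s) i (z s) := by
          intro z; ext j; by_cases h : j = i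
          · subst h; simp
          · simp [h]
        simp only [key, BoundedContinuousFunction.smul_apply]
        have := p.map_update_smul (fun j ↦ φ j s) i c (x s)
        rw [smul_eq_mul] at this
        convert this }
    (μ.real Set.univ * ‖p‖) (by
      intro φ
      refine (norm_integral_le_of_norm_le_const (C := ‖p‖ * ∏ i, ‖φ i‖)
        (Eventually.of_forall fun s ↦ ?_)).trans (by rw [mul_comm, mul_assoc])
      exact (p.le_opNorm _).trans (by gcongr with i; exact (φ i).norm_coe_le_norm s))

theorem integralMultilinear_apply {n : ℕ} (p : X [×n]→L[ℂ] ℂ) (φ : Fin n → S →ᵇ X) :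
    integralMultilinear μ p φ = ∫ s, p (fun i ↦ φ i s) ∂μ := rfl

theorem norm_integralMultilinear_le {n : ℕ} (p : X [×n]→L[ℂ] ℂ) :
    ‖integralMultilinear μ p‖ ≤ μ.real Set.univ * ‖p‖ :=
  MultilinearMap.mkContinuous_norm_le _ (by positivity) _

/-- The parameter is moved into the Banach space of bounded continuous functions, where the power
series of `G` can be integrated term by term: the terms are dominated by `‖p n‖ * ‖φ‖ ^ n`.
Holomorphy in an ordinary parameter then follows by composing with an affine map. -/
theorem hasFPowerSeriesOnBall_integral {G : X → ℂ} {p : FormalMultilinearSeries ℂ X ℂ} {c : X}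
    {r : ENNReal} (hG : HasFPowerSeriesOnBall G p c r) :
    HasFPowerSeriesOnBall (fun φ : S →ᵇ X ↦ ∫ s, G (c + φ s) ∂μ)
      (fun n ↦ integralMultilinear μ (p n)) 0 r where
  r_le := by
    refine hG.r_le.trans (ENNReal.le_of_forall_nnreal_lt fun r' hr' ↦ ?_)
    obtain ⟨C, -, hC⟩ := p.norm_mul_pow_le_of_lt_radius hr'
    refine FormalMultilinearSeries.le_radius_of_bound _ (μ.real Set.univ * C) fun n ↦ ?_
    calc ‖integralMultilinear μ (p n)‖ * (r' : ℝ) ^ n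
        ≤ μ.real Set.univ * ‖p n‖ * (r' : ℝ) ^ n := by
          gcongr; exact norm_integralMultilinear_le μ (p n)
      _ = μ.real Set.univ * (‖p n‖ * (r' : ℝ) ^ n) := by ring
      _ ≤ _ := by gcongr; exact hC n
  r_pos := hG.r_pos
  hasSum := by
    intro φ hφ
    have hφ' : ((‖φ‖₊ : NNReal) : ENNReal) < r := by
      simpa [Metric.mem_eball, edist_zero_right, enorm_eq_nnnorm] using hφ
    have hs : Summable fun n ↦ ‖p n‖ * ‖φ‖ ^ n := by
      simpa using p.summable_norm_mul_pow (hφ'.trans_le hG.r_le)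
    simp only [zero_add, integralMultilinear_apply]
    have hb : ∀ n s, ‖p n (fun _ ↦ φ s)‖ ≤ ‖p n‖ * ‖φ‖ ^ n := fun n s ↦ by
      refine ((p n).le_opNorm _).trans ?_
      simp only [Finset.prod_const, Finset.card_univ, Fintype.card_fin]
      gcongr; exact φ.norm_coe_le_norm s
    refine hasSum_integral_of_dominated_convergence (fun n _ ↦ ‖p n‖ * ‖φ‖ ^ n)
      (fun n ↦ (integrable_multilinear_comp μ (p n) fun _ ↦ φ).aestronglyMeasurable)
      (fun n ↦ Eventually.of_forall (hb n)) (Eventually.of_forall fun _ ↦ hs)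
      (integrable_const _) (Eventually.of_forall fun s ↦ ?_)
    refine hG.hasSum ?_
    have h2 : (‖φ s‖₊ : ENNReal) ≤ ‖φ‖₊ := by
      exact_mod_cast φ.norm_coe_le_norm s
    simpa [Metric.mem_eball, edist_zero_right, enorm_eq_nnnorm] using h2.trans_lt hφ'

/-- The map sending `x` to the function `t ↦ (γ t - γ t₀, x - x₀)` is affine, so the integral is a
composition with the functional above. Integrability is recorded so that integrals over disjoint
pieces can be added. -/
theorem analyticAt_and_integrable_near {E Y : Type*} [NormedAddCommGroup E] [NormedSpace ℂ E]
    [NormedAddCommGroup Y] [NormedSpace ℂ Y] {G : Y × E → ℂ} {γ : ℝ → Y} (hγ : Continuous γ)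
    {x₀ : E} {t₀ : ℝ} (hG : AnalyticAt ℂ G (γ t₀, x₀)) :
    ∃ O : Set ℝ, IsOpen O ∧ t₀ ∈ O ∧ ∀ s ⊆ O, MeasurableSet s →
      AnalyticAt ℂ (fun x ↦ ∫ t in s, G (γ t, x)) x₀ ∧
        ∀ᶠ x in 𝓝 x₀, IntegrableOn (fun t ↦ G (γ t, x)) s := by
  obtain ⟨p, r₁, hp⟩ := hG
  obtain ⟨ε, hε, hεG⟩ := Metric.eventually_nhds_iff_ball.1
    (hp.hasFPowerSeriesAt.continuousAt.norm.eventually_lt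
      (continuousAt_const (y := ‖G (γ t₀, x₀)‖ + 1)) (by simp))
  set C := ‖G (γ t₀, x₀)‖ + 1
  obtain ⟨r, hr0, hr1, hrε⟩ : ∃ r : ℝ, 0 < r ∧ ENNReal.ofReal r ≤ r₁ ∧ r ≤ ε := by
    rcases eq_or_ne r₁ ⊤ with h | h
    · exact ⟨ε, hε, by simp [h], le_rfl⟩
    · refine ⟨min ε r₁.toReal, lt_min hε (ENNReal.toReal_pos hp.r_pos.ne' h), ?_, min_le_left _ _⟩
      exact (ENNReal.ofReal_le_ofReal (min_le_right _ _)).trans (ENNReal.ofReal_toReal h).le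
  have hp' := hp.mono (ENNReal.ofReal_pos.2 hr0) hr1
  have hball : ∀ y ∈ Metric.ball (γ t₀, x₀) r, ‖G y‖ < C := fun y hy ↦
    hεG y (Metric.ball_subset_ball hrε hy)
  -- The unit ball around `t₀` serves only to make the measure finite.
  refine ⟨γ ⁻¹' Metric.ball (γ t₀) (r / 2) ∩ Metric.ball t₀ 1,
    (Metric.isOpen_ball.preimage hγ).inter Metric.isOpen_ball, ⟨?_, ?_⟩, fun s hs hsm ↦ ?_⟩
  · simpa using hr0
  · simp
  have hγs : ∀ t ∈ s, dist (γ t) (γ t₀) < r / 2 := fun t ht ↦ (hs ht).1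
  have hfin : volume s < ⊤ :=
    (measure_mono (hs.trans Set.inter_subset_right)).trans_lt measure_ball_lt_top
  have hmem : ∀ t ∈ s, ∀ x ∈ Metric.ball x₀ (r / 2), (γ t, x) ∈ Metric.ball (γ t₀, x₀) r := by
    intro t ht x hx
    rw [Metric.mem_ball, Prod.dist_eq]
    exact max_lt ((hγs t ht).trans (by linarith)) ((Metric.mem_ball.1 hx).trans (by linarith))
  constructor
  · let μ : Measure s := volume.comap Subtype.val
    have hμ : IsFiniteMeasure μ := ⟨by
      rw [MeasurableEmbedding.comap_apply (MeasurableEmbedding.subtype_coe hsm)]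
      simpa using hfin⟩
    have key := hasFPowerSeriesOnBall_integral μ hp'
    let φ₀ : s →ᵇ Y × E := BoundedContinuousFunction.ofNormedAddCommGroup
      (fun t ↦ (γ t - γ t₀, (0 : E))) (by fun_prop) (r / 2) (fun t ↦ by
        rw [Prod.norm_def]
        refine max_le ?_ (by simpa using (half_pos hr0).le)
        rw [← dist_eq_norm]; exact (hγs t t.2).le)
    let A : E →L[ℂ] (s →ᵇ Y × E) := LinearMap.mkContinuous
      { toFun := fun y ↦ BoundedContinuousFunction.const s ((0 : Y), y)
        map_add' := fun x y ↦ by ext <;> simp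
        map_smul' := fun c y ↦ by ext <;> simp } 1 (fun y ↦ by
          refine (BoundedContinuousFunction.norm_le (by positivity)).2 fun t ↦ ?_
          simp [Prod.norm_def])
    have hφ₀ : φ₀ ∈ Metric.eball (0 : s →ᵇ Y × E) (ENNReal.ofReal r) := by
      rw [Metric.eball_ofReal, mem_ball_zero_iff]
      exact (BoundedContinuousFunction.norm_ofNormedAddCommGroup_le _ (by positivity) _).trans_lt
        (by linarith)
    have h1 := key.analyticAt_of_mem hφ₀
    have h2 : AnalyticAt ℂ (fun x : E ↦ φ₀ + A (x - x₀)) x₀ :=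
      analyticAt_const.add ((A.analyticAt _).comp (analyticAt_id.sub analyticAt_const))
    have h3 := AnalyticAt.fun_comp (g := fun φ : s →ᵇ Y × E ↦ ∫ t, G ((γ t₀, x₀) + φ t) ∂μ)
      (f := fun x : E ↦ φ₀ + A (x - x₀)) (x := x₀) (by simpa using h1) h2
    refine h3.congr (Eventually.of_forall fun x ↦ ?_)
    simp only
    rw [← integral_subtype_comap hsm]
    refine integral_congr_ae (Eventually.of_forall fun t ↦ ?_)
    simp [φ₀, A]
  · filter_upwards [Metric.ball_mem_nhds x₀ (half_pos hr0)] with x hx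
    have hms : AEStronglyMeasurable (fun t ↦ G (γ t, x)) (volume.restrict s) := by
      refine ContinuousOn.aestronglyMeasurable (fun t ht ↦ ?_) hsm
      have h4 : AnalyticAt ℂ G (γ t, x) := by
        refine hp'.analyticAt_of_mem ?_
        rw [Metric.eball_ofReal]; exact hmem t ht x hx
      exact (ContinuousAt.comp (f := fun t ↦ (γ t, x)) h4.continuousAt
        (by fun_prop)).continuousWithinAt
    have : IsFiniteMeasure (volume.restrict s) := ⟨by simpa using hfin⟩
    exact Integrable.of_bound hms C ((ae_restrict_iff' hsm).2
      (Eventually.of_forall fun t ht ↦ (hball _ (hmem t ht x hx)).le))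

/-- Compactness induction. Quantifying over all measurable `s ⊆ O` makes the property stable under
unions, by splitting `s` into `s ∩ O` and `s \ O`. -/
theorem analyticAt_setIntegral {E Y : Type*} [NormedAddCommGroup E] [NormedSpace ℂ E]
    [NormedAddCommGroup Y] [NormedSpace ℂ Y] {G : Y × E → ℂ} {γ : ℝ → Y} (hγ : Continuous γ)
    {x₀ : E} {K : Set ℝ} (hK : IsCompact K) (hG : ∀ t ∈ K, AnalyticAt ℂ G (γ t, x₀))
    {s : Set ℝ} (hs : MeasurableSet s) (hsK : s ⊆ K) :
    AnalyticAt ℂ (fun x ↦ ∫ t in s, G (γ t, x)) x₀ := by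
  have key : ∃ O : Set ℝ, MeasurableSet O ∧ K ⊆ O ∧ ∀ s ⊆ O, MeasurableSet s →
      AnalyticAt ℂ (fun x ↦ ∫ t in s, G (γ t, x)) x₀ ∧
        ∀ᶠ x in 𝓝 x₀, IntegrableOn (fun t ↦ G (γ t, x)) s := by
    refine hK.induction_on (p := fun K ↦ ∃ O : Set ℝ, MeasurableSet O ∧ K ⊆ O ∧
      ∀ s ⊆ O, MeasurableSet s → AnalyticAt ℂ (fun x ↦ ∫ t in s, G (γ t, x)) x₀ ∧
        ∀ᶠ x in 𝓝 x₀, IntegrableOn (fun t ↦ G (γ t, x)) s) ?_ ?_ ?_ ?_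
    · refine ⟨∅, MeasurableSet.empty, subset_rfl, fun s hs _ ↦ ?_⟩
      obtain rfl := Set.subset_empty_iff.1 hs
      simpa using analyticAt_const
    · rintro a b hab ⟨O, h1, h2, h3⟩
      exact ⟨O, h1, hab.trans h2, h3⟩
    · rintro a b ⟨O, h1, h2, h3⟩ ⟨O', h1', h2', h3'⟩
      refine ⟨O ∪ O', h1.union h1', Set.union_subset_union h2 h2', fun s hs hsm ↦ ?_⟩
      obtain ⟨i1, i2⟩ := h3 (s ∩ O) Set.inter_subset_right (hsm.inter h1)
      obtain ⟨j1, j2⟩ := h3' (s \ O) (fun x hx ↦ (hs hx.1).resolve_left hx.2) (hsm.diff h1)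
      refine ⟨(i1.add j1).congr ?_, ?_⟩
      · filter_upwards [i2, j2] with x hx hx'
        refine integral_inter_add_sdiff h1 ?_
        rw [← Set.inter_union_sdiff s O]
        exact hx.union hx'
      · filter_upwards [i2, j2] with x hx hx'
        rw [← Set.inter_union_sdiff s O]
        exact hx.union hx'
    · intro t ht
      obtain ⟨O, h1, h2, h3⟩ := analyticAt_and_integrable_near hγ (hG t ht)
      exact ⟨O, mem_nhdsWithin_of_mem_nhds (h1.mem_nhds h2), O, h1.measurableSet, subset_rfl, h3⟩
  obtain ⟨O, -, h2, h3⟩ := key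
  exact (h3 s (hsK.trans h2) hs).1

theorem analyticAt_circleIntegral {E : Type*} [NormedAddCommGroup E] [NormedSpace ℂ E]
    {G : ℂ × E → ℂ} {x₀ : E} {c : ℂ} {ρ : ℝ} (hρ : 0 ≤ ρ)
    (hG : ∀ ζ ∈ Metric.sphere c ρ, AnalyticAt ℂ G (ζ, x₀)) :
    AnalyticAt ℂ (fun x ↦ ∮ ζ in C(c, ρ), G (ζ, x)) x₀ := by
  have h := analyticAt_setIntegral (G := fun y : ℂ × E ↦ (y.1 - c) * Complex.I * G y)
    (γ := circleMap c ρ) (continuous_circleMap c ρ) (x₀ := x₀) (K := Set.Icc 0 (2 * Real.pi))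
    isCompact_Icc (fun t _ ↦ ((analyticAt_fst.sub analyticAt_const).mul analyticAt_const).mul
      (hG _ (circleMap_mem_sphere c hρ t))) (s := Set.Ioc 0 (2 * Real.pi)) measurableSet_Ioc
      Set.Ioc_subset_Icc_self
  refine h.congr (Eventually.of_forall fun x ↦ ?_)
  simp [circleIntegral, intervalIntegral.integral_of_le Real.two_pi_pos.le, deriv_circleMap]

end ParametricIntegral

/-! ### Cauchy integrals along parallel complex lines. -/

section HartogsExtension

variable {E : Type*} [NormedAddCommGroup E] [NormedSpace ℂ E]

/-- The Cauchy integral of `f` over the circle of radius `ρ` about `p` in the direction `e`,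
where `z` is a linear coordinate with `z e = 1`. -/
noncomputable def lineCauchyIntegral (f : E → ℂ) (z : E →L[ℂ] ℂ) (e p : E) (ρ : ℝ) (x : E) : ℂ :=
  (2 * Real.pi * Complex.I)⁻¹ *
    ∮ ζ in C(0, ρ), (ζ - z (x - p))⁻¹ * f (x + (ζ - z (x - p)) • e)

/-- Only the values of `f` on the circle `‖ζ‖ = ρ` of the line `x + ℂ e` enter, so holomorphy holds
even where `f` is singular inside the disc. -/
theorem analyticAt_lineCauchyIntegral {f : E → ℂ} {z : E →L[ℂ] ℂ} {e p x : E} {ρ : ℝ}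
    (hx : ‖z (x - p)‖ < ρ)
    (hf : ∀ ζ : ℂ, ‖ζ‖ = ρ → AnalyticAt ℂ f (x + (ζ - z (x - p)) • e)) :
    AnalyticAt ℂ (lineCauchyIntegral f z e p ρ) x := by
  refine analyticAt_const.mul (analyticAt_circleIntegral
    (G := fun y : ℂ × E ↦ (y.1 - z (y.2 - p))⁻¹ * f (y.2 + (y.1 - z (y.2 - p)) • e))
    ((norm_nonneg _).trans hx.le) fun ζ hζ ↦ ?_)
  have hζ' : ‖ζ‖ = ρ := by simpa using hζ
  have h1 : AnalyticAt ℂ (fun y : ℂ × E ↦ y.1 - z (y.2 - p)) (ζ, x) :=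
    analyticAt_fst.sub ((z.analyticAt _).comp (analyticAt_snd.sub analyticAt_const))
  refine (h1.inv ?_).mul (AnalyticAt.fun_comp (hf ζ hζ') (analyticAt_snd.add
    (h1.smul analyticAt_const)))
  intro h
  rw [sub_eq_zero] at h
  simp only at h
  rw [h] at hζ'
  exact hx.ne hζ'

theorem lineCauchyIntegral_eq {f : E → ℂ} {z : E →L[ℂ] ℂ} {e p x : E} {ρ : ℝ}
    (hx : ‖z (x - p)‖ < ρ)
    (hf : ∀ ζ : ℂ, ‖ζ‖ ≤ ρ → AnalyticAt ℂ f (x + (ζ - z (x - p)) • e)) :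
    lineCauchyIntegral f z e p ρ x = f x := by
  have hd : ∀ ζ ∈ Metric.closedBall (0 : ℂ) ρ,
      DifferentiableAt ℂ (fun ζ ↦ f (x + (ζ - z (x - p)) • e)) ζ := fun ζ hζ ↦
    (hf ζ (by simpa using hζ)).differentiableAt.fun_comp' ζ (by fun_prop)
  have h := Complex.circleIntegral_sub_inv_smul_of_differentiable_on_off_countable
    (c := 0) (R := ρ) (w := z (x - p)) Set.countable_empty (by simpa using hx)
    (fun ζ hζ ↦ (hd ζ hζ).continuousAt.continuousWithinAt)
    (fun ζ hζ ↦ hd ζ (Metric.ball_subset_closedBall hζ.1))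
  simp only [smul_eq_mul] at h
  rw [lineCauchyIntegral, h]
  have : (2 * Real.pi * Complex.I : ℂ) ≠ 0 := Complex.two_pi_I_ne_zero
  field_simp
  simp

end HartogsExtension

/-! ### Uniqueness of exact decompositions in rank two. -/

section Factorization

open Filter Topology

variable {E : Type*} [NormedAddCommGroup E] [NormedSpace ℂ E]

/-- If two products of linear forms agree, then the first factor on the right is proportional to
one of the factors on the left. -/
theorem wedge_mul_wedge_eq_zero {α β γ δ : E →L[ℂ] ℂ}
    (h : ∀ u v, α u * β v + β u * α v = γ u * δ v + δ u * γ v) (u v u' v' : E) :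
    (γ u * α v - γ v * α u) * (γ u' * β v' - γ v' * β u') = 0 := by
  -- Both vectors lie in the kernel of `γ`, where the right side of `h` vanishes. Evaluation at `(a,
  -- a)` kills `α a` or `β a`; in the second case evaluation at `(a, b)` gives `α a * β b = 0`.
  set a := γ u • v - γ v • u with ha
  set b := γ u' • v' - γ v' • u' with hb
  have hγa : γ a = 0 := by simp [ha, mul_comm]
  have hγb : γ b = 0 := by simp [hb, mul_comm]
  have e1 : γ u * α v - γ v * α u = α a := by simp [ha]
  have e2 : γ u' * β v' - γ v' * β u' = β b := by simp [hb]
  rw [e1, e2]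
  have haa := h a a
  have hab := h a b
  simp only [hγa, hγb, zero_mul, mul_zero, add_zero] at haa hab
  have haa' : α a * β a = 0 := by linear_combination haa / 2
  rcases mul_eq_zero.1 haa' with h0 | h0
  · simp [h0]
  · simpa [h0] using hab

/-- The pair `f, g` of holomorphic functions satisfies `W = df dg` on `U`. -/
structure IsExactProductOn (W : E → E → E → ℂ) (f g : E → ℂ) (U : Set E) : Prop where
  left : AnalyticOnNhd ℂ f U
  right : AnalyticOnNhd ℂ g U
  eq : ∀ x ∈ U, ∀ u v, W x u v =
    (fderiv ℂ f x u * fderiv ℂ g x v + fderiv ℂ g x u * fderiv ℂ f x v) / 2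

/-- The quadratic form of the symmetric bilinear form `B` has rank at least two: some
`2 × 2` Gram determinant is nonzero. -/
def HasNonzeroGram (B : E → E → ℂ) : Prop := ∃ u v, B u v ^ 2 ≠ B u u * B v v

variable {W : E → E → E → ℂ} {f g f₁ f₂ g₁ g₂ : E → ℂ} {U V : Set E}

namespace IsExactProductOn

theorem mono (h : IsExactProductOn W f g V) (hUV : U ⊆ V) : IsExactProductOn W f g U :=
  ⟨h.left.mono hUV, h.right.mono hUV, fun x hx ↦ h.eq x (hUV hx)⟩

theorem swap (h : IsExactProductOn W f g U) : IsExactProductOn W g f U :=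
  ⟨h.right, h.left, fun x hx u v ↦ by rw [h.eq x hx]; ring⟩

/-- The Gram expression `W(u,v)² - W(u,u) W(v,v)` of `df dg` is a quarter of the square of `(df ∧
dg)(u, v)`. -/
theorem wedge_ne_zero (h : IsExactProductOn W f g U) {x : E} (hx : x ∈ U)
    (hW : HasNonzeroGram (W x)) :
    ∃ u v, fderiv ℂ f x u * fderiv ℂ g x v - fderiv ℂ f x v * fderiv ℂ g x u ≠ 0 := by
  obtain ⟨u, v, huv⟩ := hW
  refine ⟨u, v, fun h0 ↦ huv ?_⟩
  simp only [h.eq x hx]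
  linear_combination (fderiv ℂ f x u * fderiv ℂ g x v - fderiv ℂ f x v * fderiv ℂ g x u) / 4 * h0

theorem affine (h : IsExactProductOn W f g U) {c : ℂ} (hc : c ≠ 0) (d e : ℂ) :
    IsExactProductOn W (fun x ↦ c * f x + d) (fun x ↦ c⁻¹ * g x + e) U where
  left := (analyticOnNhd_const.mul h.left).add analyticOnNhd_const
  right := (analyticOnNhd_const.mul h.right).add analyticOnNhd_const
  eq x hx u v := by
    have h1 : fderiv ℂ (fun x ↦ c * f x + d) x = c • fderiv ℂ f x := by
      rw [fderiv_add_const, fderiv_const_mul (h.left x hx).differentiableAt]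
    have h2 : fderiv ℂ (fun x ↦ c⁻¹ * g x + e) x = c⁻¹ • fderiv ℂ g x := by
      rw [fderiv_add_const, fderiv_const_mul (h.right x hx).differentiableAt]
    rw [h.eq x hx, h1, h2]
    simp only [smul_apply, smul_eq_mul]
    field_simp

theorem congr (h : IsExactProductOn W f g U) (hU : IsOpen U) {f' g' : E → ℂ}
    (hf : Set.EqOn f' f U) (hg : Set.EqOn g' g U) : IsExactProductOn W f' g' U where
  left := h.left.congr hU hf.symm
  right := h.right.congr hU hg.symm
  eq x hx u v := by
    rw [(hf.eventuallyEq_of_mem (hU.mem_nhds hx)).fderiv_eq,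
      (hg.eventuallyEq_of_mem (hU.mem_nhds hx)).fderiv_eq, h.eq x hx]

end IsExactProductOn

theorem AnalyticAt.analyticAt_fderiv_apply {f : E → ℂ} {x : E} (hf : AnalyticAt ℂ f x) (u : E) :
    AnalyticAt ℂ (fun y ↦ fderiv ℂ f y u) x :=
  ((ContinuousLinearMap.apply ℂ ℂ u : (E →L[ℂ] ℂ) →L[ℂ] ℂ).analyticAt _).comp hf.fderiv

/-- If `dg = h df` near `x`, then `dh ∧ df = 0` at `x`. -/
theorem fderiv_mul_fderiv_comm_of_eq_smul {f g h : E → ℂ} {x : E} (hf : AnalyticAt ℂ f x)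
    (hg : AnalyticAt ℂ g x) (hh : AnalyticAt ℂ h x)
    (heq : ∀ᶠ y in 𝓝 x, ∀ u, fderiv ℂ g y u = h y * fderiv ℂ f y u) (a b : E) :
    fderiv ℂ h x a * fderiv ℂ f x b = fderiv ℂ h x b * fderiv ℂ f x a := by
  have hsymm : ∀ {k : E → ℂ}, AnalyticAt ℂ k x → ∀ u v,
      fderiv ℂ (fderiv ℂ k) x u v = fderiv ℂ (fderiv ℂ k) x v u := fun hk u v ↦
    (hk.contDiffAt (n := ω)).isSymmSndFDerivAt_of_omega u v
  have heq' : fderiv ℂ g =ᶠ[𝓝 x] fun y ↦ h y • fderiv ℂ f y := by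
    filter_upwards [heq] with y hy
    ext u; simp [hy]
  -- This is `d(dg) = 0`: the derivative of `h df` is `dh ⊗ df + h D²f`, and symmetry of both second
  -- derivatives leaves `dh ∧ df = 0`.
  have hD := heq'.fderiv_eq (𝕜 := ℂ)
  rw [fderiv_fun_smul hh.differentiableAt hf.fderiv.differentiableAt] at hD
  have key := hsymm hg a b
  rw [hD] at key
  simp only [add_apply, smul_apply, ContinuousLinearMap.smulRight_apply, smul_eq_mul] at key
  linear_combination key - h x * hsymm hf a b

theorem AnalyticOnNhd.eqOn_zero_or_eqOn_zero_of_mul {V : Set E} {a b : E → ℂ}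
    (hV : IsOpen V) (hVc : IsPreconnected V) (ha : AnalyticOnNhd ℂ a V) (hb : AnalyticOnNhd ℂ b V)
    (hab : ∀ x ∈ V, a x * b x = 0) : (∀ x ∈ V, a x = 0) ∨ ∀ x ∈ V, b x = 0 := by
  by_contra! hcon
  obtain ⟨⟨x, hx, hax⟩, y, hy, hby⟩ := hcon
  refine hby (hb.eqOn_zero_of_preconnected_of_eventuallyEq_zero hVc hx ?_ hy)
  filter_upwards [(ha x hx).continuousAt.eventually_ne hax, hV.mem_nhds hx] with z hz hzV
  exact (mul_eq_zero.1 (hab z hzV)).resolve_left hz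

/-- If `dg₁ ∧ df₁ = 0` and `W = df₁ df₂ = dg₁ dg₂` has rank two at some point, then `g₁` is an
affine function of `f₁` and `f₂` is an affine function of `g₂`. -/
theorem IsExactProductOn.exists_affine_of_wedge_eq_zero
    (hf : IsExactProductOn W f₁ f₂ V) (hg : IsExactProductOn W g₁ g₂ V) (hV : IsOpen V)
    (hVc : IsPreconnected V) {x₀ : E} (hx₀ : x₀ ∈ V) (hW : HasNonzeroGram (W x₀))
    (hwedge : ∀ x ∈ V, ∀ u v, fderiv ℂ g₁ x u * fderiv ℂ f₁ x v
      - fderiv ℂ g₁ x v * fderiv ℂ f₁ x u = 0) :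
    ∃ c d e : ℂ, c ≠ 0 ∧ ∀ x ∈ V, g₁ x = c * f₁ x + d ∧ f₂ x = c * g₂ x + e := by
  obtain ⟨u₀, v₀, huv⟩ := hf.wedge_ne_zero hx₀ hW
  obtain ⟨e, he⟩ : ∃ e, fderiv ℂ f₁ x₀ e ≠ 0 := by
    by_contra! hcon
    simp [hcon] at huv
  set h : E → ℂ := fun x ↦ fderiv ℂ g₁ x e / fderiv ℂ f₁ x e with hh
  have hD : ∀ {k : E → ℂ}, AnalyticAt ℂ k x₀ → ∀ u, ContinuousAt (fun x ↦ fderiv ℂ k x u) x₀ :=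
    fun hk u ↦ (hk.analyticAt_fderiv_apply u).continuousAt
  have hnear : ∀ᶠ x in 𝓝 x₀, x ∈ V ∧ fderiv ℂ f₁ x e ≠ 0 ∧
      fderiv ℂ f₁ x u₀ * fderiv ℂ f₂ x v₀ - fderiv ℂ f₁ x v₀ * fderiv ℂ f₂ x u₀ ≠ 0 := by
    have a1 := hf.left x₀ hx₀
    have a2 := hf.right x₀ hx₀
    filter_upwards [hV.mem_nhds hx₀, (hD a1 e).eventually_ne he,
      (((hD a1 u₀).mul (hD a2 v₀)).sub ((hD a1 v₀).mul (hD a2 u₀))).eventually_ne huv]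
      with x h1 h2 h3 using ⟨h1, h2, h3⟩
  obtain ⟨ε, hε, hball⟩ := Metric.eventually_nhds_iff_ball.1 hnear
  have hh_an : ∀ x ∈ Metric.ball x₀ ε, AnalyticAt ℂ h x := fun x hx ↦
    ((hg.left x (hball x hx).1).analyticAt_fderiv_apply e).fun_div
      ((hf.left x (hball x hx).1).analyticAt_fderiv_apply e) (hball x hx).2.1
  have h1 : ∀ x ∈ Metric.ball x₀ ε, ∀ u, fderiv ℂ g₁ x u = h x * fderiv ℂ f₁ x u := by
    intro x hx u
    have := hwedge x (hball x hx).1 u e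
    have h0 := (hball x hx).2.1
    simp only [hh]
    field_simp
    linear_combination this
  have h2 : ∀ x ∈ Metric.ball x₀ ε, ∀ v, fderiv ℂ f₂ x v = h x * fderiv ℂ g₂ x v := by
    intro x hx
    have h0 := (hball x hx).2.1
    -- Substituting `dg₁ = h df₁` gives `df₁ · (df₂ - h dg₂) = 0` with `df₁ ≠ 0`; the second factor
    -- dies by testing on `(e, e)` and then `(e, v)`.
    have key : ∀ u v, fderiv ℂ f₁ x u * (fderiv ℂ f₂ x v - h x * fderiv ℂ g₂ x v)
        + fderiv ℂ f₁ x v * (fderiv ℂ f₂ x u - h x * fderiv ℂ g₂ x u) = 0 := by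
      intro u v
      have e1 := hf.eq x (hball x hx).1 u v
      rw [hg.eq x (hball x hx).1 u v, h1 x hx u, h1 x hx v] at e1
      linear_combination -2 * e1
    have kee := key e e
    have ke' : fderiv ℂ f₁ x e * (fderiv ℂ f₂ x e - h x * fderiv ℂ g₂ x e) = 0 := by
      linear_combination kee / 2
    have ke := (mul_eq_zero.1 ke').resolve_left h0
    intro v
    have := key e v
    rw [ke, mul_zero, add_zero] at this
    exact sub_eq_zero.1 ((mul_eq_zero.1 this).resolve_left h0)
  -- The relations `dg₁ = h df₁` and `df₂ = h dg₂` give `dh ∧ df₁ = 0` and `dh ∧ dg₂ = 0`, hence `dh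
  -- ∧ df₂ = 0`. Since `df₁` and `df₂` are independent, `dh = 0`.
  have hdh : ∀ x ∈ Metric.ball x₀ ε, fderiv ℂ h x = 0 := by
    intro x hx
    have hxV := (hball x hx).1
    have hnhds := Metric.isOpen_ball.mem_nhds hx
    have c1 := fderiv_mul_fderiv_comm_of_eq_smul (hf.left x hxV) (hg.left x hxV) (hh_an x hx)
      (by filter_upwards [hnhds] with y hy using h1 y hy)
    have c2 := fderiv_mul_fderiv_comm_of_eq_smul (hg.right x hxV) (hf.right x hxV) (hh_an x hx)
      (by filter_upwards [hnhds] with y hy using h2 y hy)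
    have c2' : ∀ a b, fderiv ℂ h x a * fderiv ℂ f₂ x b = fderiv ℂ h x b * fderiv ℂ f₂ x a := by
      intro a b
      rw [h2 x hx a, h2 x hx b]
      linear_combination h x * c2 a b
    ext a
    have key : fderiv ℂ h x a * (fderiv ℂ f₁ x u₀ * fderiv ℂ f₂ x v₀
        - fderiv ℂ f₁ x v₀ * fderiv ℂ f₂ x u₀) = 0 := by
      linear_combination fderiv ℂ f₂ x v₀ * c1 a u₀ + fderiv ℂ f₁ x a * c2' u₀ v₀
        - fderiv ℂ f₂ x u₀ * c1 a v₀
    exact (mul_eq_zero.1 key).resolve_right (hball x hx).2.2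
  have hx₀ε := Metric.mem_ball_self (x := x₀) hε
  have hconst : ∀ {k : E → ℂ}, DifferentiableOn ℂ k (Metric.ball x₀ ε) →
      (∀ x ∈ Metric.ball x₀ ε, fderiv ℂ k x = 0) → ∀ x ∈ Metric.ball x₀ ε, k x = k x₀ := by
    intro k hk hk0 x hx
    exact Metric.isOpen_ball.is_const_of_fderiv_eq_zero (convex_ball x₀ ε).isPreconnected hk hk0
      hx hx₀ε
  have hhc := hconst (fun x hx ↦ (hh_an x hx).differentiableAt.differentiableWithinAt) hdh
  have extend : ∀ {k l : E → ℂ}, AnalyticOnNhd ℂ k V → AnalyticOnNhd ℂ l V →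
      (∀ x ∈ Metric.ball x₀ ε, ∀ u, fderiv ℂ k x u = h x * fderiv ℂ l x u) →
      ∀ x ∈ V, k x = h x₀ * l x + (k x₀ - h x₀ * l x₀) := by
    intro k l hk hl hkl x hx
    have hm : AnalyticOnNhd ℂ (fun x ↦ k x - h x₀ * l x) V :=
      hk.sub (analyticOnNhd_const.mul hl)
    have hmc := hconst (k := fun x ↦ k x - h x₀ * l x)
      (fun x hx ↦ (hm x (hball x hx).1).differentiableAt.differentiableWithinAt) (by
        intro x hx
        have d1 := (hk x (hball x hx).1).differentiableAt
        have d2 := (hl x (hball x hx).1).differentiableAt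
        rw [fderiv_fun_sub d1 (d2.const_mul _), fderiv_const_mul d2]
        ext u
        simp [hkl x hx u, hhc x hx])
    have := hm.eqOn_of_preconnected_of_eventuallyEq (analyticOnNhd_const
      (v := k x₀ - h x₀ * l x₀)) hVc hx₀
      (by filter_upwards [Metric.ball_mem_nhds x₀ hε] with y hy using hmc y hy) hx
    simp only at this
    linear_combination this
  refine ⟨h x₀, _, _, ?_, fun x hx ↦ ⟨extend hg.left hf.left h1 x hx,
    extend hf.right hg.right h2 x hx⟩⟩
  intro h0
  simp [h2 x₀ hx₀ε, h0] at huv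

/-- Pointwise, one of the two wedges vanishes by `wedge_mul_wedge_eq_zero`. Analytic functions on a
connected open set have no zero divisors, so the same alternative holds throughout `V`. -/
theorem IsExactProductOn.wedge_eq_zero_or
    (hf : IsExactProductOn W f₁ f₂ V) (hg : IsExactProductOn W g₁ g₂ V) (hV : IsOpen V)
    (hVc : IsPreconnected V) :
    (∀ x ∈ V, ∀ u v, fderiv ℂ g₁ x u * fderiv ℂ f₁ x v
      - fderiv ℂ g₁ x v * fderiv ℂ f₁ x u = 0) ∨
    (∀ x ∈ V, ∀ u v, fderiv ℂ g₁ x u * fderiv ℂ f₂ x v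
      - fderiv ℂ g₁ x v * fderiv ℂ f₂ x u = 0) := by
  by_contra! hcon
  obtain ⟨⟨x, hx, u, v, h1⟩, y, hy, u', v', h2⟩ := hcon
  have an : ∀ {k : E → ℂ}, AnalyticOnNhd ℂ k V → ∀ u v,
      AnalyticOnNhd ℂ (fun x ↦ fderiv ℂ g₁ x u * fderiv ℂ k x v
        - fderiv ℂ g₁ x v * fderiv ℂ k x u) V := fun hk u v x hx ↦
    (((hg.left x hx).analyticAt_fderiv_apply u).mul ((hk x hx).analyticAt_fderiv_apply v)).sub
      (((hg.left x hx).analyticAt_fderiv_apply v).mul ((hk x hx).analyticAt_fderiv_apply u))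
  rcases AnalyticOnNhd.eqOn_zero_or_eqOn_zero_of_mul hV hVc (an hf.left u v) (an hf.right u' v')
    (fun z hz ↦ wedge_mul_wedge_eq_zero (δ := fderiv ℂ g₂ z) (fun a b ↦ by
      linear_combination 2 * (hg.eq z hz a b) - 2 * (hf.eq z hz a b)) u v u' v') with h | h
  · exact h1 (h x hx)
  · exact h2 (h y hy)

end Factorization

/-! ### Gluing decompositions along connected overlaps. -/

section Gluing

open Filter Topology

variable {E : Type*} [NormedAddCommGroup E] [NormedSpace ℂ E] {W : E → E → E → ℂ}
  {f g f₁ f₂ g₁ g₂ : E → ℂ} {U V Ω : Set E}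

theorem IsExactProductOn.union (hf : IsExactProductOn W f₁ f₂ U)
    (hg : IsExactProductOn W g₁ g₂ V) (hU : IsOpen U) (hV : IsOpen V)
    (h₁ : Set.EqOn f₁ g₁ (U ∩ V)) (h₂ : Set.EqOn f₂ g₂ (U ∩ V)) :
    ∃ k₁ k₂, IsExactProductOn W k₁ k₂ (U ∪ V) := by
  classical
  have hpu : ∀ a b : E → ℂ, Set.EqOn (U.piecewise a b) a U := fun a b ↦ U.piecewise_eqOn a b
  have hpv : ∀ {a b : E → ℂ}, Set.EqOn a b (U ∩ V) → Set.EqOn (U.piecewise a b) b V := by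
    intro a b hab x hx
    by_cases hxU : x ∈ U
    · rw [Set.piecewise_eq_of_mem _ _ _ hxU, hab ⟨hxU, hx⟩]
    · rw [Set.piecewise_eq_of_notMem _ _ _ hxU]
  have hu := hf.congr hU (hpu f₁ g₁) (hpu f₂ g₂)
  have hv := hg.congr hV (hpv h₁) (hpv h₂)
  refine ⟨_, _, fun x hx ↦ hx.elim (hu.left x) (hv.left x),
    fun x hx ↦ hx.elim (hu.right x) (hv.right x), fun x hx ↦ hx.elim (hu.eq x) (hv.eq x)⟩

/-- `W` is the product of two exact holomorphic differentials on `U`. -/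
def HasExactProductOn (W : E → E → E → ℂ) (U : Set E) : Prop :=
  ∃ f g, IsExactProductOn W f g U

theorem HasExactProductOn.mono (h : HasExactProductOn W V) (hUV : U ⊆ V) :
    HasExactProductOn W U := by
  obtain ⟨f, g, h⟩ := h
  exact ⟨f, g, h.mono hUV⟩

theorem hasExactProductOn_empty : HasExactProductOn W ∅ :=
  ⟨0, 0, by simp [AnalyticOnNhd], by simp [AnalyticOnNhd], by simp⟩

/-- `W` has rank at least two at points of every nonempty open subset of `Ω`. -/
def HasGenericRankTwoOn (W : E → E → E → ℂ) (Ω : Set E) : Prop :=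
  ∀ O ⊆ Ω, IsOpen O → O.Nonempty → ∃ x ∈ O, HasNonzeroGram (W x)

/-- On the connected overlap a single affine change, after a possible swap of factors, matches the
two decompositions; it is applied on all of `V`. -/
theorem HasExactProductOn.union (hW : HasGenericRankTwoOn W Ω) (hf : HasExactProductOn W U)
    (hg : HasExactProductOn W V) (hU : IsOpen U) (hV : IsOpen V) (hUΩ : U ⊆ Ω)
    (hUV : IsPreconnected (U ∩ V)) : HasExactProductOn W (U ∪ V) := by
  obtain ⟨f₁, f₂, hf⟩ := hf
  obtain ⟨g₁, g₂, hg⟩ := hg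
  rcases (U ∩ V).eq_empty_or_nonempty with hemp | hne
  · exact hf.union hg hU hV (by simp [hemp]) (by simp [hemp])
  obtain ⟨x₀, hx₀, hx₀W⟩ := hW (U ∩ V) (Set.inter_subset_left.trans hUΩ) (hU.inter hV) hne
  have main : ∀ {a b : E → ℂ}, IsExactProductOn W a b U →
      (∀ x ∈ U ∩ V, ∀ u v, fderiv ℂ g₁ x u * fderiv ℂ a x v
        - fderiv ℂ g₁ x v * fderiv ℂ a x u = 0) → HasExactProductOn W (U ∪ V) := by
    intro a b hab hw
    obtain ⟨c, d, e, hc, h⟩ := (hab.mono Set.inter_subset_left).exists_affine_of_wedge_eq_zero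
      (hg.mono Set.inter_subset_right) (hU.inter hV) hUV hx₀ hx₀W hw
    refine hab.union (hg.affine (inv_ne_zero hc) (-d / c) e) hU hV (fun x hx ↦ ?_) fun x hx ↦ ?_
    · simp only [(h x hx).1]
      field_simp
      ring
    · simp only [(h x hx).2, inv_inv]
  rcases (hf.mono Set.inter_subset_left).wedge_eq_zero_or (hg.mono Set.inter_subset_right)
    (hU.inter hV) hUV with h | h
  · exact main hf h
  · exact main hf.swap h

/-- Exact product decompositions on finitely many convex open sets glue if all triple
intersections are nonempty. -/
theorem hasExactProductOn_biUnion [NormedSpace ℝ E] (hW : HasGenericRankTwoOn W Ω) {ι : Type*}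
    (s : Finset ι) {F : ι → Set E} (hF : ∀ i, HasExactProductOn W (F i)) (ho : ∀ i, IsOpen (F i))
    (hc : ∀ i, Convex ℝ (F i)) (hΩ : ∀ i, F i ⊆ Ω)
    (hne : ∀ i j k, (F i ∩ F j ∩ F k).Nonempty) :
    HasExactProductOn W (⋃ i ∈ s, F i) := by
  classical
  induction s using Finset.induction_on with
  | empty => simpa using hasExactProductOn_empty
  | insert k s hk ih =>
    rw [Finset.set_biUnion_insert, Set.union_comm]
    refine ih.union hW (hF k) (isOpen_biUnion fun i _ ↦ ho i) (ho k)
      (Set.iUnion₂_subset fun i _ ↦ hΩ i) ?_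
    rw [Set.iUnion₂_inter]
    -- The overlap is a union of convex sets `F i ∩ F k`, any two of which share a point of a triple
    -- intersection.
    refine IsPreconnected.biUnion_of_reflTransGen
      (fun i _ ↦ ((hc i).inter (hc k)).isPreconnected) fun i hi j hj ↦ ?_
    refine Relation.ReflTransGen.single ⟨?_, hi⟩
    obtain ⟨x, ⟨h1, h2⟩, h3⟩ := hne i j k
    exact ⟨x, ⟨h1, h3⟩, h2, h3⟩

/-- Sweep `C` by windows of width `η` advanced by `η / 2`. Each new window meets the part already
covered in a convex set, and boundedness of `φ` on `C` makes the process finite. -/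
theorem HasExactProductOn.of_slabs [NormedSpace ℝ E] (hW : HasGenericRankTwoOn W Ω) {C : Set E}
    (hC : Convex ℝ C) (hCo : IsOpen C) (hCΩ : C ⊆ Ω) (φ : E →L[ℝ] ℝ) {η : ℝ} (hη : 0 < η)
    (hb : Bornology.IsBounded (φ '' C))
    (h : ∀ a, HasExactProductOn W (C ∩ φ ⁻¹' Set.Ioo a (a + η))) : HasExactProductOn W C := by
  have hconv : ∀ a b, Convex ℝ (C ∩ φ ⁻¹' Set.Ioo a b) := fun a b ↦
    hC.inter ((convex_Ioo a b).linear_preimage φ.toLinearMap)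
  have hopen : ∀ a b, IsOpen (C ∩ φ ⁻¹' Set.Ioo a b) := fun a b ↦
    hCo.inter (isOpen_Ioo.preimage φ.continuous)
  obtain ⟨r, hr⟩ := hb.subset_ball 0
  have key : ∀ n : ℕ, HasExactProductOn W (C ∩ φ ⁻¹' Set.Ioo (-r) (-r + (n + 1) * (η / 2))) := by
    intro n
    induction n with
    | zero =>
      refine (h (-r)).mono (Set.inter_subset_inter_right _ (Set.preimage_mono
        (Set.Ioo_subset_Ioo_right ?_)))
      push_cast; linarith
    | succ n ih =>
      refine (ih.union hW (h (-r + n * (η / 2))) (hopen _ _) (hopen _ _)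
        (Set.inter_subset_left.trans hCΩ) ?_).mono ?_
      · exact ((hconv _ _).inter (hconv _ _)).isPreconnected
      · rintro x ⟨hx, h1, h2⟩
        by_cases hlt : φ x < -r + (n + 1) * (η / 2)
        · exact Or.inl ⟨hx, h1, hlt⟩
        · refine Or.inr ⟨hx, ?_, ?_⟩
          · linarith
          · push_cast at h2; linarith
  obtain ⟨n, hn⟩ := exists_nat_gt (2 * r / (η / 2))
  refine (key n).mono fun x hx ↦ ⟨hx, ?_⟩
  have hxr : |φ x| < r := by simpa using hr (Set.mem_image_of_mem φ hx)
  rw [div_lt_iff₀ (by positivity)] at hn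
  obtain ⟨h1, h2⟩ := abs_lt.1 hxr
  exact ⟨h1, by nlinarith⟩

/-- A convex open set in a compact set, on a neighbourhood of each point of which `W` is an
exact product, carries an exact product decomposition. -/
theorem hasExactProductOn_of_convex [FiniteDimensional ℂ E] (hW : HasGenericRankTwoOn W Ω)
    {C K : Set E} (hC : Convex ℝ C) (hCo : IsOpen C) (hCΩ : C ⊆ Ω) (hCK : C ⊆ K)
    (hK : IsCompact K) (hloc : ∀ x ∈ K, ∃ U ∈ 𝓝 x, HasExactProductOn W U) :
    HasExactProductOn W C := by
  classical
  have : FiniteDimensional ℝ E := FiniteDimensional.complexToReal E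
  choose! U hU hUW using hloc
  obtain ⟨δ, hδ, hleb⟩ := lebesgue_number_lemma_of_metric (c := fun x : K ↦ interior (U x)) hK
    (fun _ ↦ isOpen_interior) fun x hx ↦
    Set.mem_iUnion.2 ⟨⟨x, hx⟩, mem_interior_iff_mem_nhds.2 (hU x hx)⟩
  have hball : ∀ x ∈ K, HasExactProductOn W (Metric.ball x δ) := fun x hx ↦ by
    obtain ⟨y, hy⟩ := hleb x hx
    exact (hUW y y.2).mono (hy.trans interior_subset)
  let b := Module.finBasis ℝ E
  let φ : Fin (Module.finrank ℝ E) → E →L[ℝ] ℝ := fun i ↦ LinearMap.toContinuousLinearMap (b.coord i)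
  set N := ∑ i, ‖b i‖ with hN
  have hN0 : 0 ≤ N := Finset.sum_nonneg fun i _ ↦ norm_nonneg _
  set η := δ / (N + 1) with hηdef
  have hη : 0 < η := by positivity
  -- Induction on the set `s` of real coordinates not yet confined to an interval of length `η`.
  -- When it is empty, the choice of `η` puts `D` inside a ball of the Lebesgue radius `δ`.
  have key : ∀ s : Finset (Fin (Module.finrank ℝ E)), ∀ D ⊆ C, IsOpen D → Convex ℝ D →
      (∀ i ∉ s, ∃ a, D ⊆ φ i ⁻¹' Set.Ioo a (a + η)) → HasExactProductOn W D := by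
    intro s
    induction s using Finset.induction_on with
    | empty =>
      intro D hDC hDo hDc hD
      rcases D.eq_empty_or_nonempty with rfl | ⟨x, hx⟩
      · exact hasExactProductOn_empty
      refine (hball x (hCK (hDC hx))).mono fun y hy ↦ ?_
      have hcoord : ∀ i, |b.repr (y - x) i| ≤ η := fun i ↦ by
        obtain ⟨a, ha⟩ := hD i (by simp)
        have h1 : a < b.repr x i ∧ b.repr x i < a + η := ha hx
        have h2 : a < b.repr y i ∧ b.repr y i < a + η := ha hy
        rw [map_sub, Finsupp.sub_apply, abs_le]
        constructor <;> linarith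
      rw [Metric.mem_ball, dist_eq_norm, ← b.sum_repr (y - x)]
      calc ‖∑ i, b.repr (y - x) i • b i‖ ≤ ∑ i, η * ‖b i‖ := by
            refine norm_sum_le_of_le _ fun i _ ↦ ?_
            rw [norm_smul]
            gcongr
            exact hcoord i
        _ = δ * (N / (N + 1)) := by rw [← Finset.mul_sum, ← hN, hηdef]; ring
        _ < δ * 1 := by
          gcongr
          rw [div_lt_one (by positivity)]; linarith
        _ = δ := mul_one δ
    | insert k s hk ih =>
      intro D hDC hDo hDc hD
      refine HasExactProductOn.of_slabs hW hDc hDo (hDC.trans hCΩ) (φ k) hη ?_ fun a ↦ ?_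
      · exact ((hK.image (φ k).continuous).isBounded).subset
          (Set.image_mono (hDC.trans hCK))
      · refine ih _ (Set.inter_subset_left.trans hDC)
          (hDo.inter (isOpen_Ioo.preimage (φ k).continuous))
          (hDc.inter ((convex_Ioo _ _).linear_preimage (φ k).toLinearMap)) fun i hi ↦ ?_
        by_cases hik : i = k
        · subst hik
          exact ⟨a, Set.inter_subset_right⟩
        · obtain ⟨a', ha'⟩ := hD i (by simp [hik, hi])
          exact ⟨a', Set.inter_subset_left.trans ha'⟩
  exact key Finset.univ C subset_rfl hCo hC fun i hi ↦ absurd (Finset.mem_univ i) hi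

end Gluing

/-! ### A real 4-simplex in `ℂ × ℂ`. -/

section Simplex

/-- Five real linear forms on `ℂ × ℂ` with sum zero: the real coordinates and minus their sum.
The set where all of them are at most `c` is a simplex. -/
noncomputable def simplexForm : Fin 5 → (ℂ × ℂ →L[ℝ] ℝ) :=
  let re₁ := Complex.reCLM.comp (ContinuousLinearMap.fst ℝ ℂ ℂ)
  let im₁ := Complex.imCLM.comp (ContinuousLinearMap.fst ℝ ℂ ℂ)
  let re₂ := Complex.reCLM.comp (ContinuousLinearMap.snd ℝ ℂ ℂ)
  let im₂ := Complex.imCLM.comp (ContinuousLinearMap.snd ℝ ℂ ℂ)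
  ![-(re₁ + im₁ + re₂ + im₂), re₁, im₁, re₂, im₂]

theorem simplexForm_zero (v : ℂ × ℂ) :
    simplexForm 0 v = -(v.1.re + v.1.im + v.2.re + v.2.im) := rfl
theorem simplexForm_one (v : ℂ × ℂ) : simplexForm 1 v = v.1.re := rfl
theorem simplexForm_two (v : ℂ × ℂ) : simplexForm 2 v = v.1.im := rfl
theorem simplexForm_three (v : ℂ × ℂ) : simplexForm 3 v = v.2.re := rfl
theorem simplexForm_four (v : ℂ × ℂ) : simplexForm 4 v = v.2.im := rfl

/-- Inside the simplex each real coordinate is at most `c`, and at least `-4c` because of the form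
with index 0. So each complex coordinate has norm at most `4√2 c < 6c`. -/
theorem exists_lt_simplexForm {c : ℝ} (hc : 0 < c) {v : ℂ × ℂ} (hv : 6 * c < ‖v‖) :
    ∃ i, c < simplexForm i v := by
  by_contra! h
  have h0 := h 0
  have h1 := h 1
  have h2 := h 2
  have h3 := h 3
  have h4 := h 4
  rw [simplexForm_zero] at h0
  rw [simplexForm_one] at h1
  rw [simplexForm_two] at h2
  rw [simplexForm_three] at h3
  rw [simplexForm_four] at h4
  have bound : ∀ z : ℂ, |z.re| ≤ 4 * c → |z.im| ≤ 4 * c → ‖z‖ ≤ 6 * c := by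
    intro z hr hi
    rw [Complex.norm_eq_sqrt_sq_add_sq, Real.sqrt_le_iff]
    have := sq_le_sq' (abs_le.1 hr).1 (abs_le.1 hr).2
    have := sq_le_sq' (abs_le.1 hi).1 (abs_le.1 hi).2
    exact ⟨by positivity, by nlinarith⟩
  refine hv.not_ge ?_
  rw [Prod.norm_def]
  refine max_le (bound _ (abs_le.2 ⟨?_, ?_⟩) (abs_le.2 ⟨?_, ?_⟩))
    (bound _ (abs_le.2 ⟨?_, ?_⟩) (abs_le.2 ⟨?_, ?_⟩)) <;> linarith

theorem lt_norm_of_lt_simplexForm {c : ℝ} (hc : 0 < c) {v : ℂ × ℂ} {i : Fin 5}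
    (h : c < simplexForm i v) : c / 4 < ‖v‖ := by
  have h1 := abs_le.1 ((Complex.abs_re_le_norm v.1).trans (norm_fst_le v))
  have h2 := abs_le.1 ((Complex.abs_im_le_norm v.1).trans (norm_fst_le v))
  have h3 := abs_le.1 ((Complex.abs_re_le_norm v.2).trans (norm_snd_le v))
  have h4 := abs_le.1 ((Complex.abs_im_le_norm v.2).trans (norm_snd_le v))
  fin_cases i
  · have h' : c < -(v.1.re + v.1.im + v.2.re + v.2.im) := h
    linarith
  · have h' : c < v.1.re := h
    linarith
  · have h' : c < v.1.im := h
    linarith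
  · have h' : c < v.2.re := h
    linarith
  · have h' : c < v.2.im := h
    linarith

/-- For each index there is a point near the opposite vertex of the simplex at which all other
forms are large. -/
theorem exists_forall_ne_lt_simplexForm {c : ℝ} (hc : 0 < c) (m : Fin 5) :
    ∃ v : ℂ × ℂ, ‖v‖ < 10 * c ∧ ∀ i, i ≠ m → c < simplexForm i v := by
  have bound : ∀ a b : ℝ, |a| + |b| < 10 * c → ‖(⟨a, b⟩ : ℂ)‖ < 10 * c := fun a b h ↦
    (Complex.norm_le_abs_re_add_abs_im _).trans_lt h
  -- All coordinates are `3c/2`, except that for `m ≠ 0` the one with index `m` is `-6c`; minus the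
  -- sum is then `6c - 9c/2 = 3c/2 > c`.
  have hs : |3 / 2 * c| = 3 / 2 * c := abs_of_pos (by positivity)
  have hl : |-(6 * c)| = 6 * c := by rw [abs_neg]; exact abs_of_pos (by positivity)
  have hss : ‖(⟨3 / 2 * c, 3 / 2 * c⟩ : ℂ)‖ < 10 * c := bound _ _ (by rw [hs]; linarith)
  have hls : ‖(⟨-(6 * c), 3 / 2 * c⟩ : ℂ)‖ < 10 * c := bound _ _ (by rw [hs, hl]; linarith)
  have hsl : ‖(⟨3 / 2 * c, -(6 * c)⟩ : ℂ)‖ < 10 * c := bound _ _ (by rw [hs, hl]; linarith)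
  have fin5 : ∀ (v : ℂ × ℂ) (m : Fin 5),
      (0 ≠ m → c < -(v.1.re + v.1.im + v.2.re + v.2.im)) → (1 ≠ m → c < v.1.re) →
      (2 ≠ m → c < v.1.im) → (3 ≠ m → c < v.2.re) → (4 ≠ m → c < v.2.im) →
      ∀ i, i ≠ m → c < simplexForm i v := by
    intro v m h0 h1 h2 h3 h4 i
    fin_cases i
    exacts [h0, h1, h2, h3, h4]
  fin_cases m
  · exact ⟨(⟨3 / 2 * c, 3 / 2 * c⟩, ⟨3 / 2 * c, 3 / 2 * c⟩), max_lt hss hss,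
      fin5 _ _ (by simp) (by intro; dsimp only; linarith) (by intro; dsimp only; linarith)
        (by intro; dsimp only; linarith) (by intro; dsimp only; linarith)⟩
  · exact ⟨(⟨-(6 * c), 3 / 2 * c⟩, ⟨3 / 2 * c, 3 / 2 * c⟩), max_lt hls hss,
      fin5 _ _ (by intro; dsimp only; linarith) (by simp) (by intro; dsimp only; linarith)
        (by intro; dsimp only; linarith) (by intro; dsimp only; linarith)⟩
  · exact ⟨(⟨3 / 2 * c, -(6 * c)⟩, ⟨3 / 2 * c, 3 / 2 * c⟩), max_lt hsl hss,
      fin5 _ _ (by intro; dsimp only; linarith) (by intro; dsimp only; linarith) (by simp)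
        (by intro; dsimp only; linarith) (by intro; dsimp only; linarith)⟩
  · exact ⟨(⟨3 / 2 * c, 3 / 2 * c⟩, ⟨-(6 * c), 3 / 2 * c⟩), max_lt hss hls,
      fin5 _ _ (by intro; dsimp only; linarith) (by intro; dsimp only; linarith)
        (by intro; dsimp only; linarith) (by simp) (by intro; dsimp only; linarith)⟩
  · exact ⟨(⟨3 / 2 * c, 3 / 2 * c⟩, ⟨3 / 2 * c, -(6 * c)⟩), max_lt hss hsl,
      fin5 _ _ (by intro; dsimp only; linarith) (by intro; dsimp only; linarith)
        (by intro; dsimp only; linarith) (by intro; dsimp only; linarith) (by simp)⟩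

end Simplex

/-! ### Extension across a point isolated in a transversal plane. -/

section Extension

open Filter Topology

variable {E : Type*} [NormedAddCommGroup E] [NormedSpace ℂ E]

theorem convex_norm_sub_lt {F : Type*} [NormedAddCommGroup F] [NormedSpace ℂ F] (A : E →L[ℂ] F)
    (p : E) (s : ℝ) : Convex ℝ {x | ‖A (x - p)‖ < s} := by
  convert (convex_ball (A p) s).linear_preimage (A.restrictScalars ℝ).toLinearMap using 1
  ext x
  simp [dist_eq_norm]

theorem isOpen_norm_sub_lt {F : Type*} [NormedAddCommGroup F] [NormedSpace ℂ F] (A : E →L[ℂ] F)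
    (p : E) (s : ℝ) : IsOpen {x | ‖A (x - p)‖ < s} :=
  isOpen_lt (by fun_prop) continuous_const

theorem exists_plane_coordinates [FiniteDimensional ℂ E] {L : Submodule ℂ E}
    (hL : Module.finrank ℂ L = 2) :
    ∃ (ι : ℂ × ℂ →L[ℂ] E) (Q : E →L[ℂ] ℂ × ℂ), (∀ v, ι v ∈ L) ∧ ∀ v, Q (ι v) = v := by
  let e : L ≃ₗ[ℂ] ℂ × ℂ := LinearEquiv.ofFinrankEq _ _ (by simp [hL])
  obtain ⟨Q, hQ⟩ := LinearMap.exists_leftInverse_of_injective (L.subtype ∘ₗ e.symm.toLinearMap)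
    (LinearMap.ker_eq_bot.2 (L.injective_subtype.comp e.symm.injective))
  exact ⟨LinearMap.toContinuousLinearMap (L.subtype ∘ₗ e.symm.toLinearMap),
    LinearMap.toContinuousLinearMap Q, fun v ↦ (e.symm v).2, fun v ↦ LinearMap.congr_fun hQ v⟩

theorem exists_hasExactProductOn_nhds [FiniteDimensional ℂ E] {W : E → E → E → ℂ} {Ω Y : Set E}
    (hΩ : IsOpen Ω) (hWan : ∀ u v, AnalyticOnNhd ℂ (fun x ↦ W x u v) Ω)
    (hW : HasGenericRankTwoOn W Ω) (hYo : IsOpen Y) (hYΩ : Y ⊆ Ω)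
    (hY : ∀ x ∈ Y, ∃ U ∈ 𝓝 x, HasExactProductOn W U) {p : E} (hp : p ∈ Ω) {L : Submodule ℂ E}
    (hL : Module.finrank ℂ L = 2) (hLY : ∀ᶠ y in 𝓝[≠] p, y - p ∈ L → y ∈ Y) :
    ∃ D ∈ 𝓝 p, HasExactProductOn W D := by
  obtain ⟨ι, Q, hι, hQι⟩ := exists_plane_coordinates hL
  obtain ⟨r, hr, hball⟩ := Metric.eventually_nhds_iff_ball.1
    ((eventually_nhdsWithin_iff.1 hLY).and (hΩ.mem_nhds hp))
  -- `Q` gives the coordinates along the plane and `P` the transversal component.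
  set P : E →L[ℂ] E := ContinuousLinearMap.id ℂ E - ι.comp Q with hPdef
  have hP : ∀ x, x = ι (Q x) + P x := fun x ↦ by simp [hPdef]
  have hPι : ∀ v, P (ι v) = 0 := fun v ↦ by simp [hPdef, hQι]
  obtain ⟨c, hc, hcr⟩ : ∃ c : ℝ, 0 < c ∧ ∀ v : ℂ × ℂ, ‖v‖ ≤ 10 * c → ‖ι v‖ ≤ r / 2 := by
    refine ⟨r / (20 * (‖ι‖ + 1)), by positivity, fun v hv ↦ (ι.le_opNorm v).trans ?_⟩
    calc ‖ι‖ * ‖v‖ ≤ (‖ι‖ + 1) * (10 * (r / (20 * (‖ι‖ + 1)))) := by gcongr; linarith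
      _ = r / 2 := by field_simp; norm_num
  have hKc : IsCompact ((fun v ↦ p + ι v) '' {v : ℂ × ℂ | c / 4 ≤ ‖v‖ ∧ ‖v‖ ≤ 10 * c}) := by
    refine IsCompact.image ?_ (by fun_prop)
    refine Metric.isCompact_of_isClosed_isBounded
      ((isClosed_le continuous_const continuous_norm).inter
        (isClosed_le continuous_norm continuous_const))
      ((Metric.isBounded_closedBall (x := (0 : ℂ × ℂ)) (r := 10 * c)).subset fun v hv ↦ ?_)
    simpa using hv.2
  have hKY : ((fun v ↦ p + ι v) '' {v : ℂ × ℂ | c / 4 ≤ ‖v‖ ∧ ‖v‖ ≤ 10 * c}) ⊆ Y := by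
    rintro _ ⟨v, ⟨hv1, hv2⟩, rfl⟩
    refine (hball _ ?_).1 ?_ (by simpa using hι v)
    · simpa using (hcr v hv2).trans_lt (by linarith)
    · intro h
      have h0 : ι v = 0 := by simpa using h
      have : v = 0 := by rw [← hQι v, h0, map_zero]
      rw [this, norm_zero] at hv1
      linarith
  -- The inner radius `c / 4` is the bound that holds on every outer side of the simplex, so that
  -- the compact set `A` contains all the sets `F i`.
  obtain ⟨δ₀, hδ₀, hthick⟩ := hKc.exists_cthickening_subset_open hYo hKY
  set δ := min δ₀ (r / 4) with hδdef
  have hδ : 0 < δ := lt_min hδ₀ (by positivity)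
  set A : Set E := {x | c / 4 ≤ ‖Q (x - p)‖ ∧ ‖Q (x - p)‖ ≤ 10 * c ∧ ‖P (x - p)‖ ≤ δ} with hA
  have hAY : A ⊆ Y := by
    rintro x ⟨h1, h2, h3⟩
    refine hthick (Metric.mem_cthickening_of_dist_le x (p + ι (Q (x - p))) _ _
      ⟨_, ⟨h1, h2⟩, rfl⟩ ?_)
    have h : x - (p + ι (Q (x - p))) = P (x - p) := by
      rw [sub_add_eq_sub_sub, sub_eq_iff_eq_add', ← hP]
    rw [dist_eq_norm, h]
    exact h3.trans (min_le_left _ _)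
  have hnear : ∀ x, ‖Q (x - p)‖ ≤ 10 * c → ‖P (x - p)‖ ≤ δ → dist x p < r := by
    intro x h1 h2
    rw [dist_eq_norm, hP (x - p)]
    refine (norm_add_le _ _).trans_lt ?_
    have := hcr _ h1
    have := h2.trans (min_le_right _ _)
    linarith
  have hAc : IsCompact A := by
    have : ProperSpace E := FiniteDimensional.proper ℂ E
    refine Metric.isCompact_of_isClosed_isBounded ?_
      (Metric.isBounded_ball.subset fun x hx ↦ hnear x hx.2.1 hx.2.2)
    have hQc : Continuous fun x ↦ ‖Q (x - p)‖ := by fun_prop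
    have hPc : Continuous fun x ↦ ‖P (x - p)‖ := by fun_prop
    exact (isClosed_le continuous_const hQc).inter
      ((isClosed_le hQc continuous_const).inter (isClosed_le hPc continuous_const))
  let F : Fin 5 → Set E := fun i ↦ {x | c < simplexForm i (Q (x - p))} ∩
    ({x | ‖Q (x - p)‖ < 10 * c} ∩ {x | ‖P (x - p)‖ < δ})
  have hFA : ∀ i, F i ⊆ A := fun i x hx ↦
    ⟨(lt_norm_of_lt_simplexForm hc hx.1).le, le_of_lt hx.2.1, le_of_lt hx.2.2⟩
  have hFo : ∀ i, IsOpen (F i) := fun i ↦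
    (isOpen_lt continuous_const (by fun_prop)).inter
      ((isOpen_norm_sub_lt Q p _).inter (isOpen_norm_sub_lt P p _))
  have hFc : ∀ i, Convex ℝ (F i) := fun i ↦ by
    refine Convex.inter ?_ ((convex_norm_sub_lt Q p _).inter (convex_norm_sub_lt P p _))
    convert (convex_Ioi (c + simplexForm i (Q p))).linear_preimage
      ((simplexForm i).comp (Q.restrictScalars ℝ)).toLinearMap using 1
    ext x
    simp [lt_sub_iff_add_lt]
  -- Three indices omit some `m` among five; a point near the vertex opposite to facet `m` lies in
  -- all the other sets.
  have hFne : ∀ i j k, (F i ∩ F j ∩ F k).Nonempty := fun i j k ↦ by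
    have hm : ∀ i j k : Fin 5, ∃ m, i ≠ m ∧ j ≠ m ∧ k ≠ m := by decide
    obtain ⟨m, hi, hj, hk⟩ := hm i j k
    obtain ⟨v, hv, hvm⟩ := exists_forall_ne_lt_simplexForm hc m
    have : ∀ l, l ≠ m → p + ι v ∈ F l := fun l hl ↦ by
      refine ⟨?_, ?_, ?_⟩
      · simpa [hQι] using hvm l hl
      · simpa [hQι] using hv
      · simpa [hPι] using hδ
    exact ⟨p + ι v, ⟨this i hi, this j hj⟩, this k hk⟩
  have hFW : ∀ i, HasExactProductOn W (F i) := fun i ↦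
    hasExactProductOn_of_convex hW (hFc i) (hFo i) ((hFA i).trans (hAY.trans hYΩ)) (hFA i) hAc
      fun x hx ↦ hY x (hAY hx)
  obtain ⟨f, g, hfg⟩ := hasExactProductOn_biUnion hW Finset.univ hFW hFo hFc
    (fun i ↦ (hFA i).trans (hAY.trans hYΩ)) hFne
  have hT : ∀ x, 6 * c < ‖Q (x - p)‖ → ‖Q (x - p)‖ < 10 * c → ‖P (x - p)‖ < δ →
      x ∈ ⋃ i ∈ (Finset.univ : Finset (Fin 5)), F i := fun x h1 h2 h3 ↦ by
    obtain ⟨i, hi⟩ := exists_lt_simplexForm hc h1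
    exact Set.mem_biUnion (Finset.mem_univ i) ⟨hi, h2, h3⟩
  set z₁ : E →L[ℂ] ℂ := (ContinuousLinearMap.fst ℂ ℂ ℂ).comp Q with hz₁
  set z₂ : E →L[ℂ] ℂ := (ContinuousLinearMap.snd ℂ ℂ ℂ).comp Q with hz₂
  -- The radii satisfy `6c < 8c < 10c`. The circle `‖ζ‖ = 8c` always lies in the shell, and where
  -- `‖z₂‖ > 6c` so does the whole disc it bounds.
  set D : Set E := {x | ‖z₁ (x - p)‖ < 8 * c} ∩ ({x | ‖z₂ (x - p)‖ < 10 * c} ∩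
    {x | ‖P (x - p)‖ < δ}) with hD
  have hDo : IsOpen D := (isOpen_norm_sub_lt z₁ p _).inter
    ((isOpen_norm_sub_lt z₂ p _).inter (isOpen_norm_sub_lt P p _))
  have hDc : Convex ℝ D := (convex_norm_sub_lt z₁ p _).inter
    ((convex_norm_sub_lt z₂ p _).inter (convex_norm_sub_lt P p _))
  have hpD : p ∈ D := ⟨by simpa using hc, by simpa using hc, by simpa using hδ⟩
  have hDΩ : D ⊆ Ω := fun x hx ↦ by
    refine (hball x (hnear x (max_le (le_of_lt hx.1 |>.trans (by linarith)) (le_of_lt hx.2.1))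
      (le_of_lt hx.2.2))).2
  have hshift : ∀ x (ζ : ℂ), Q (x + (ζ - z₁ (x - p)) • ι (1, 0) - p) = (ζ, z₂ (x - p)) ∧
      P (x + (ζ - z₁ (x - p)) • ι (1, 0) - p) = P (x - p) := fun x ζ ↦ by
    have h : x + (ζ - z₁ (x - p)) • ι (1, 0) - p =
      (x - p) + (ζ - z₁ (x - p)) • ι (1, 0) := by abel
    rw [h, map_add, map_add, map_smul, map_smul, hQι, hPι]
    constructor
    · ext <;> simp [hz₁, hz₂]
    · simp
  have hshiftT : ∀ x ∈ D, ∀ ζ : ℂ, ‖ζ‖ ≤ 8 * c → (6 * c < ‖ζ‖ ∨ 6 * c < ‖z₂ (x - p)‖) →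
      x + (ζ - z₁ (x - p)) • ι (1, 0) ∈ ⋃ i ∈ (Finset.univ : Finset (Fin 5)), F i := by
    intro x hx ζ hζ h
    obtain ⟨e1, e2⟩ := hshift x ζ
    refine hT _ ?_ ?_ ?_
    · rw [e1, Prod.norm_def]
      exact lt_max_iff.2 h
    · rw [e1, Prod.norm_def]
      exact max_lt (by linarith) hx.2.1
    · rw [e2]; exact hx.2.2
  set N : Set E := D ∩ {x | 6 * c < ‖z₂ (x - p)‖} with hN
  have hNo : IsOpen N := hDo.inter (isOpen_lt continuous_const (by fun_prop))
  have hext : ∀ {k : E → ℂ}, AnalyticOnNhd ℂ k (⋃ i ∈ (Finset.univ : Finset (Fin 5)), F i) →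
      AnalyticOnNhd ℂ (lineCauchyIntegral k z₁ (ι (1, 0)) p (8 * c)) D ∧
      Set.EqOn (lineCauchyIntegral k z₁ (ι (1, 0)) p (8 * c)) k N := by
    intro k hk
    constructor
    · intro x hx
      exact analyticAt_lineCauchyIntegral hx.1 fun ζ hζ ↦
        hk _ (hshiftT x hx ζ hζ.le (Or.inl (by rw [hζ]; linarith)))
    · intro x hx
      exact lineCauchyIntegral_eq hx.1.1 fun ζ hζ ↦ hk _ (hshiftT x hx.1 ζ hζ (Or.inr hx.2))
  obtain ⟨hf1, hf2⟩ := hext hfg.left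
  obtain ⟨hg1, hg2⟩ := hext hfg.right
  have hNT : N ⊆ ⋃ i ∈ (Finset.univ : Finset (Fin 5)), F i := fun x hx ↦ by
    have := hshiftT x hx.1 (z₁ (x - p)) (le_of_lt hx.1.1) (Or.inr hx.2)
    simpa using this
  have hprodN := (hfg.mono hNT).congr hNo hf2 hg2
  have hxN : p + ι (0, ((7 * c : ℝ) : ℂ)) ∈ N := by
    have hn : ‖((7 * c : ℝ) : ℂ)‖ = 7 * c := by
      rw [Complex.norm_real, Real.norm_of_nonneg (by positivity)]
    refine ⟨⟨?_, ?_, ?_⟩, ?_⟩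
    · simpa [hz₁, hQι] using hc
    · simp only [Set.mem_ofPred_eq, add_sub_cancel_left, hz₂, ContinuousLinearMap.comp_apply, hQι,
        ContinuousLinearMap.coe_snd', hn]
      linarith
    · simpa [hPι] using hδ
    · simp only [Set.mem_ofPred_eq, add_sub_cancel_left, hz₂, ContinuousLinearMap.comp_apply, hQι,
        ContinuousLinearMap.coe_snd', hn]
      linarith
  refine ⟨D, hDo.mem_nhds hpD, _, _, hf1, hg1, fun x hx u v ↦ ?_⟩
  have hrhs : AnalyticOnNhd ℂ (fun x ↦
      (fderiv ℂ (lineCauchyIntegral f z₁ (ι (1, 0)) p (8 * c)) x u *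
          fderiv ℂ (lineCauchyIntegral g z₁ (ι (1, 0)) p (8 * c)) x v +
        fderiv ℂ (lineCauchyIntegral g z₁ (ι (1, 0)) p (8 * c)) x u *
          fderiv ℂ (lineCauchyIntegral f z₁ (ι (1, 0)) p (8 * c)) x v) * (2 : ℂ)⁻¹) D :=
    fun x hx ↦
    ((((hf1 x hx).analyticAt_fderiv_apply u).mul ((hg1 x hx).analyticAt_fderiv_apply v)).add
      (((hg1 x hx).analyticAt_fderiv_apply u).mul ((hf1 x hx).analyticAt_fderiv_apply v))).mul
        analyticAt_const
  -- On `N` the extensions agree with `f` and `g`, so the identity holds there; it spreads to the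
  -- convex set `D` by the identity theorem.
  have := ((hWan u v).mono hDΩ).eqOn_of_preconnected_of_eventuallyEq hrhs hDc.isPreconnected
    hxN.1 (by filter_upwards [hNo.mem_nhds hxN] with y hy using
      (hprodN.eq y hy u v).trans (div_eq_mul_inv _ _)) hx
  exact this.trans (div_eq_mul_inv _ _).symm

end Extension

/-! ### Translation between the manifold and a chart. -/

section Chart

open Filter Topology SymDiff

theorem exists_wedge_ne_zero {V : Type*} [AddCommGroup V] [TopologicalSpace V] [Module ℂ V]
    {α β : V →L[ℂ] ℂ} (h : LinearIndependent ℂ ![α, β]) :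
    ∃ u v, α u * β v - α v * β u ≠ 0 := by
  by_contra! hcon
  rw [LinearIndependent.pair_iff] at h
  by_cases hα : ∃ u, α u ≠ 0
  · obtain ⟨u, hu⟩ := hα
    refine hu (neg_eq_zero.1 (h (β u) (-α u) ?_).2)
    ext v
    have := hcon u v
    simp only [add_apply, smul_apply, smul_eq_mul, zero_apply]
    linear_combination -this
  · push Not at hα
    have := h 1 0 (by ext v; simp [hα])
    simp at this

theorem SymDiff.IsAnalyticSubset.isClosed {E : Type*} [NormedAddCommGroup E]
    [NormedSpace ℂ E] {M : Type*} [TopologicalSpace M] [ChartedSpace E M] {Z : Set M}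
    (hZ : IsAnalyticSubset E Z) :
    IsClosed Z := by
  rw [← isOpen_compl_iff, isOpen_iff_mem_nhds]
  intro p hp
  obtain ⟨U, hU, hpU, k, h, hh, hZU⟩ := hZ p
  obtain ⟨i, hi⟩ : ∃ i, h i p ≠ 0 := by
    by_contra! hcon
    exact hp ((hZU p hpU).2 hcon)
  filter_upwards [hU.mem_nhds hpU, ((hh i).continuousOn.continuousAt
    (hU.mem_nhds hpU)).eventually_ne hi] with y hy hyi hyZ
  exact hyi ((hZU y hy).1 hyZ i)

variable {E : Type*} [NormedAddCommGroup E] [NormedSpace ℂ E]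
  {M : Type*} [TopologicalSpace M] [ChartedSpace E M] [IsManifold 𝓘(ℂ, E) ω M]

/-- The symmetric differential `w` in the coordinates of the preferred chart at `p`. -/
noncomputable def chartForm (w : SymTwoDifferential E M) (p : M) (z u v : E) : ℂ :=
  w.form ((chartAt E p).symm z) (mfderiv 𝓘(ℂ, E) 𝓘(ℂ, E) (chartAt E p).symm z u)
    (mfderiv 𝓘(ℂ, E) 𝓘(ℂ, E) (chartAt E p).symm z v)

theorem contMDiffOn_iff_analyticOnNhd [CompleteSpace E] {f : E → ℂ} {U : Set E} (hU : IsOpen U) :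
    ContMDiffOn 𝓘(ℂ, E) 𝓘(ℂ, ℂ) ω f U ↔ AnalyticOnNhd ℂ f U := by
  rw [contMDiffOn_iff_contDiffOn, contDiffOn_omega_iff_analyticOn hU.uniqueDiffOn,
    hU.analyticOn_iff_analyticOnNhd]

theorem contMDiffOn_mfderiv_chart_symm (p : M) (u : E) :
    ContMDiffOn 𝓘(ℂ, E) (𝓘(ℂ, E).prod 𝓘(ℂ, E)) ω
      (fun z ↦ Bundle.TotalSpace.mk' E (E := fun x : M ↦ TangentSpace 𝓘(ℂ, E) x)
        ((chartAt E p).symm z) (mfderiv 𝓘(ℂ, E) 𝓘(ℂ, E) (chartAt E p).symm z u))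
      (chartAt E p).target := by
  have h1 := (contMDiffOn_chart_symm (I := 𝓘(ℂ, E)) (n := ω)
    (x := p)).contMDiffOn_tangentMapWithin (m := ω) le_rfl
    (chartAt E p).open_target.uniqueMDiffOn
  have h2 : ContMDiff 𝓘(ℂ, E) 𝓘(ℂ, E).tangent ω
      (fun z ↦ (⟨z, u⟩ : TangentBundle 𝓘(ℂ, E) E)) :=
    contMDiff_vectorSpace_iff_contDiff.2 contDiff_const
  have h3 := h1.comp h2.contMDiffOn (s := (chartAt E p).target) (fun z hz ↦ hz)
  refine h3.congr fun z hz ↦ ?_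
  simp only [Function.comp_apply, tangentMapWithin]
  rw [mfderivWithin_of_isOpen (chartAt E p).open_target hz]

theorem analyticOnNhd_chartForm [CompleteSpace E] (w : SymTwoDifferential E M) (p : M) (u v : E) :
    AnalyticOnNhd ℂ (fun z ↦ chartForm w p z u v) (chartAt E p).target := by
  rw [← contMDiffOn_iff_analyticOnNhd (chartAt E p).open_target]
  intro z hz
  have h1 := w.holomorphic.contMDiffAt.comp_contMDiffWithinAt z
    (contMDiffOn_chart_symm (I := 𝓘(ℂ, E)) (n := ω) (x := p) z hz)
  have h2 := ContMDiffWithinAt.clm_bundle_apply₂ (F₁ := E) (F₂ := E) (F₃ := ℂ)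
    (E₃ := Bundle.Trivial M ℂ) h1
    (contMDiffOn_mfderiv_chart_symm p u z hz) (contMDiffOn_mfderiv_chart_symm p v z hz)
  rw [Bundle.contMDiffWithinAt_totalSpace] at h2
  exact h2.2

theorem mfderiv_comp_chart_symm {f : M → ℂ} {p : M} {z : E} (hz : z ∈ (chartAt E p).target)
    (hf : MDifferentiableAt 𝓘(ℂ, E) 𝓘(ℂ, ℂ) f ((chartAt E p).symm z)) (u : E) :
    fderiv ℂ (f ∘ (chartAt E p).symm) z u =
      mfderiv 𝓘(ℂ, E) 𝓘(ℂ, ℂ) f ((chartAt E p).symm z)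
        (mfderiv 𝓘(ℂ, E) 𝓘(ℂ, E) (chartAt E p).symm z u) := by
  have : IsManifold 𝓘(ℂ, E) 1 M := IsManifold.of_le (n := ω) le_top
  rw [← mfderiv_eq_fderiv, mfderiv_comp z hf
    ((mdifferentiable_chart (I := 𝓘(ℂ, E)) p).mdifferentiableAt_symm hz)]
  rfl

theorem mfderiv_comp_chart {f : E → ℂ} {p y : M} (hy : y ∈ (chartAt E p).source)
    (hf : DifferentiableAt ℂ f (chartAt E p y)) (u : TangentSpace 𝓘(ℂ, E) y) :
    mfderiv 𝓘(ℂ, E) 𝓘(ℂ, ℂ) (f ∘ chartAt E p) y u =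
      fderiv ℂ f (chartAt E p y) (mfderiv 𝓘(ℂ, E) 𝓘(ℂ, E) (chartAt E p) y u) := by
  have : IsManifold 𝓘(ℂ, E) 1 M := IsManifold.of_le (n := ω) le_top
  rw [← mfderiv_eq_fderiv, mfderiv_comp y hf.mdifferentiableAt
    ((mdifferentiable_chart (I := 𝓘(ℂ, E)) p).mdifferentiableAt hy)]
  rfl

theorem chartForm_chart (w : SymTwoDifferential E M) {p y : M} (hy : y ∈ (chartAt E p).source)
    (u v : TangentSpace 𝓘(ℂ, E) y) :
    chartForm w p (chartAt E p y) (mfderiv 𝓘(ℂ, E) 𝓘(ℂ, E) (chartAt E p) y u)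
      (mfderiv 𝓘(ℂ, E) 𝓘(ℂ, E) (chartAt E p) y v) = w.form y u v := by
  have : IsManifold 𝓘(ℂ, E) 1 M := IsManifold.of_le (n := ω) le_top
  have h := (mdifferentiable_chart (I := 𝓘(ℂ, E)) p).symm_comp_deriv hy
  have h' : ∀ u : TangentSpace 𝓘(ℂ, E) y,
      mfderiv 𝓘(ℂ, E) 𝓘(ℂ, E) (chartAt E p).symm (chartAt E p y)
        (mfderiv 𝓘(ℂ, E) 𝓘(ℂ, E) (chartAt E p) y u) = u := fun u ↦ DFunLike.congr_fun h u
  -- The base point obtained by going through the chart and back equals `y` only propositionally, so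
  -- the change of tangent space is made by substitution.
  have key : ∀ (y' : M) (a b : E), y' = y →
      w.form y' a b = w.form y (a : TangentSpace 𝓘(ℂ, E) y) (b : TangentSpace 𝓘(ℂ, E) y) := by
    rintro y' a b rfl
    rfl
  exact (key _ _ _ ((chartAt E p).left_inv hy)).trans
    (congrArg₂ (fun a b : TangentSpace 𝓘(ℂ, E) y ↦ w.form y a b) (h' u) (h' v))

theorem hasGenericRankTwoOn_chartForm {w : SymTwoDifferential E M} (hw : w.HasRankTwo) (p : M) :
    HasGenericRankTwoOn (chartForm w p) (chartAt E p).target := by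
  intro O hO hOo ⟨z, hz⟩
  obtain ⟨x, ⟨hxO, hxs⟩, α, β, hli, hαβ⟩ := hw.inter_open_nonempty
    ((chartAt E p).source ∩ chartAt E p ⁻¹' O) ((chartAt E p).isOpen_inter_preimage hOo)
    ⟨(chartAt E p).symm z, (chartAt E p).map_target (hO hz), by
      rwa [Set.mem_preimage, (chartAt E p).right_inv (hO hz)]⟩
  refine ⟨chartAt E p x, hxs, ?_⟩
  obtain ⟨u, v, huv⟩ := exists_wedge_ne_zero hli
  refine ⟨mfderiv 𝓘(ℂ, E) 𝓘(ℂ, E) (chartAt E p) x u,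
    mfderiv 𝓘(ℂ, E) 𝓘(ℂ, E) (chartAt E p) x v, fun h ↦ huv ?_⟩
  rw [chartForm_chart w hxO, chartForm_chart w hxO, chartForm_chart w hxO, hαβ] at h
  have h' : ∀ a b : TangentSpace 𝓘(ℂ, E) x, symMul α β a b = (α a * β b + β a * α b) / 2 :=
    symMul_apply α β
  rw [h', h', h'] at h
  rw [← sq_eq_zero_iff]
  linear_combination 4 * h

theorem exists_hasExactProductOn_chartForm [CompleteSpace E] {w : SymTwoDifferential E M} {p : M}
    {z : E} (hz : z ∈ (chartAt E p).target)
    (hw : w.HasExactDecompositionAt ((chartAt E p).symm z)) :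
    ∃ U ∈ 𝓝 z, HasExactProductOn (chartForm w p) U := by
  obtain ⟨U, hU, hzU, f, g, hf, hg, hfg⟩ := hw
  have hO := (chartAt E p).isOpen_inter_preimage_symm hU
  have hdiff : ∀ {k : M → ℂ}, ContMDiffOn 𝓘(ℂ, E) 𝓘(ℂ, ℂ) ω k U → ∀ y ∈ U,
      MDifferentiableAt 𝓘(ℂ, E) 𝓘(ℂ, ℂ) k y := fun hk y hy ↦
    (hk.contMDiffAt (hU.mem_nhds hy)).mdifferentiableAt (by simp)
  have han : ∀ {k : M → ℂ}, ContMDiffOn 𝓘(ℂ, E) 𝓘(ℂ, ℂ) ω k U →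
      AnalyticOnNhd ℂ (k ∘ (chartAt E p).symm)
        ((chartAt E p).target ∩ (chartAt E p).symm ⁻¹' U) := fun hk ↦
    (contMDiffOn_iff_analyticOnNhd hO).1 (hk.comp
      ((contMDiffOn_chart_symm (I := 𝓘(ℂ, E)) (n := ω) (x := p)).mono Set.inter_subset_left)
      Set.inter_subset_right)
  refine ⟨_, hO.mem_nhds ⟨hz, hzU⟩, f ∘ (chartAt E p).symm, g ∘ (chartAt E p).symm,
    han hf, han hg, fun x hx u v ↦ ?_⟩
  simp only [mfderiv_comp_chart_symm hx.1 (hdiff hf _ hx.2),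
    mfderiv_comp_chart_symm hx.1 (hdiff hg _ hx.2)]
  rw [chartForm, hfg _ hx.2]
  exact symMul_apply (V := TangentSpace 𝓘(ℂ, E) ((chartAt E p).symm x)) _ _ _ _

theorem hasExactDecompositionAt_of_chartForm [CompleteSpace E] {w : SymTwoDifferential E M}
    {p : M} {D : Set E} (hD : D ∈ 𝓝 (chartAt E p p)) (hDw : HasExactProductOn (chartForm w p) D) :
    w.HasExactDecompositionAt p := by
  obtain ⟨O, hOD, hO, hpO⟩ := mem_nhds_iff.1 hD
  obtain ⟨f, g, hfg⟩ := hDw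
  replace hfg := hfg.mono hOD
  have hsm : ∀ {k : E → ℂ}, AnalyticOnNhd ℂ k O → ContMDiffOn 𝓘(ℂ, E) 𝓘(ℂ, ℂ) ω
      (k ∘ chartAt E p) ((chartAt E p).source ∩ chartAt E p ⁻¹' O) := fun hk ↦
    ((contMDiffOn_iff_analyticOnNhd hO).2 hk).comp
      ((contMDiffOn_chart (I := 𝓘(ℂ, E)) (n := ω) (x := p)).mono Set.inter_subset_left)
      Set.inter_subset_right
  refine ⟨(chartAt E p).source ∩ chartAt E p ⁻¹' O, (chartAt E p).isOpen_inter_preimage hO,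
    ⟨mem_chart_source E p, hpO⟩, f ∘ chartAt E p, g ∘ chartAt E p, hsm hfg.left, hsm hfg.right,
    fun y hy ↦ ?_⟩
  have h' : ∀ (α β : TangentSpace 𝓘(ℂ, E) y →L[ℂ] ℂ) (a b : TangentSpace 𝓘(ℂ, E) y),
    symMul α β a b = (α a * β b + β a * α b) / 2 := fun α β ↦ symMul_apply α β
  refine ContinuousLinearMap.ext fun u ↦ ContinuousLinearMap.ext fun v ↦ ?_
  refine (chartForm_chart w hy.1 u v).symm.trans ((hfg.eq _ hy.2 _ _).trans
    (Eq.trans ?_ (h' _ _ u v).symm))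
  have hf := fun u ↦ mfderiv_comp_chart hy.1 (hfg.left _ hy.2).differentiableAt u
  have hg := fun u ↦ mfderiv_comp_chart hy.1 (hfg.right _ hy.2).differentiableAt u
  have hc : ∀ {a b c d a' b' c' d' : ℂ}, a = a' → b = b' → c = c' → d = d' →
      (a' * b' + c' * d') / 2 = (a * b + c * d) / 2 := by
    rintro _ _ _ _ _ _ _ _ rfl rfl rfl rfl
    rfl
  exact hc (hf u) (hg v) (hg u) (hf v)

end Chart

/-! ### The extension lemma on the manifold. -/

theorem lemma2p6 {E : Type*} [NormedAddCommGroup E] [NormedSpace ℂ E] [FiniteDimensional ℂ E]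
    {M : Type*} [TopologicalSpace M] [ChartedSpace E M] [IsManifold 𝓘(ℂ, E) ω M]
    (w : SymDiff.SymTwoDifferential E M) (hrank : w.HasRankTwo)
    (Z : Set M) (hZ : SymDiff.IsAnalyticSubset E Z) (hcodim : SymDiff.CodimAtLeast E 2 Z)
    (hw : w.IsClosedOfFirstKindOn Zᶜ) :
    w.IsClosedOfFirstKind := by
  intro p
  by_cases hp : p ∈ Z
  swap
  · exact hw p hp
  have : CompleteSpace E := FiniteDimensional.complete ℂ E
  obtain ⟨L, hL, hLZ⟩ := hcodim p hp
  have hpt : chartAt E p p ∈ (chartAt E p).target := mem_chart_target E p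
  -- The codimension condition is transported by the inverse chart: near the image of `p`, the
  -- punctured plane lands in the complement of `Z`.
  have hLY : ∀ᶠ z in nhdsWithin (chartAt E p p) {chartAt E p p}ᶜ, z - chartAt E p p ∈ L →
      z ∈ (chartAt E p).target ∩ (chartAt E p).symm ⁻¹' Zᶜ := by
    rw [eventually_nhdsWithin_iff] at hLZ ⊢
    have hcont := (chartAt E p).continuousAt_symm hpt
    rw [ContinuousAt, (chartAt E p).left_inv (mem_chart_source E p)] at hcont
    filter_upwards [hcont.eventually hLZ, (chartAt E p).open_target.mem_nhds hpt]
      with z hz hzt hzp hzL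
    refine ⟨hzt, fun hzZ ↦ ?_⟩
    refine hz (fun h ↦ hzp ?_) hzZ ?_
    · rw [Set.mem_singleton_iff] at h ⊢
      rw [← congrArg (chartAt E p) h, (chartAt E p).right_inv hzt]
    · simpa [(chartAt E p).right_inv hzt] using hzL
  obtain ⟨D, hD, hDw⟩ := exists_hasExactProductOn_nhds (chartAt E p).open_target
    (analyticOnNhd_chartForm w p) (hasGenericRankTwoOn_chartForm hrank p)
    ((chartAt E p).isOpen_inter_preimage_symm hZ.isClosed.isOpen_compl) Set.inter_subset_left
    (fun z hz ↦ exists_hasExactProductOn_chartForm hz.1 (hw _ hz.2)) hpt hL hLY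
  exact hasExactDecompositionAt_of_chartForm hD hDw
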